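/- Let $(R,\mathfrak m_R)$ be a complete Noetherian local domain of Krull dimension one. Let $\mathcal X$ be an integral normal projective curve over $R$ (that is, an integral normal closed subscheme of some $\mathbb P^n_R$ whose nonempty fibres over $\operatorname{Spec} R$ have dimension one) which dominates $\operatorname{Spec} R$; let $F$ be its function field and $X$ its closed fibre. Let $U\subseteq X$ be any subset contained in an affine open subset of $\mathcal X$, let $R_U\subseteq F$ be the ring of rational functions that are regular at every point of $U$, and let $\widehat R_U$ be the $\mathfrak m_R R_U$-adic completion of $R_U$. (1) For every prime ideal $\mathfrak p\neq 0$ of $R_U$, the canonical homomorphism $R_U/\mathfrak p\to\widehat R_U/\mathfrak p\widehat R_U$ is an isomorphism; in particular $\mathfrak p\widehat R_U$ is a prime ideal of $\widehat R_U$. (2) Let $Q$ be a prime ideal of $\widehat R_U$ that is not a minimal prime, and let $\mathfrak q=Q\cap R_U$ be its preimage in $R_U$. Then $Q=\mathfrak q\widehat R_U$, and the canonical homomorphism of residue fields $k_{R_U}(\mathfrak q)\to k_{\widehat R_U}(Q)$ is an isomorphism. (3) The maps $\mathfrak p\mapsto\mathfrak p\widehat R_U$ and $Q\mapsto Q\cap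 R_U$ are mutually inverse bijections between the set of non-minimal prime ideals of $R_U$ and the set of non-minimal prime ideals of $\widehat R_U$. -/

import Mathlib

open AlgebraicGeometry CategoryTheory

universe u

namespace WeierstrassCurve32

attribute [local instance] MvPolynomial.gradedAlgebra

/-- The structure morphism of projective `n`-space over `R`, the scheme
`Proj R[X₀, …, Xₙ]` with the grading by total degree. -/
noncomputable def projectiveSpaceHom (R : Type u) [CommRing R] (n : ℕ) :
    Proj (MvPolynomial.homogeneousSubmodule (Fin (n + 1)) R) ⟶ Spec (CommRingCat.of R) :=
  Proj.toSpecZero (MvPolynomial.homogeneousSubmodule (Fin (n + 1)) R) ≫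
    Spec.map (CommRingCat.ofHom
      (algebraMap R (MvPolynomial.homogeneousSubmodule (Fin (n + 1)) R 0)))

/-- An `R`-scheme is projective if it is, over `R`, a closed subscheme of some projective space. -/
def IsProjectiveOver (R : Type u) [CommRing R] {X : Scheme.{u}}
    (f : X ⟶ Spec (CommRingCat.of R)) : Prop :=
  ∃ (n : ℕ) (i : X ⟶ Proj (MvPolynomial.homogeneousSubmodule (Fin (n + 1)) R)),
    IsClosedImmersion i ∧ i ≫ projectiveSpaceHom R n = f

/-- A scheme is normal if all its local rings are integrally closed domains. -/
def IsNormalScheme (X : Scheme.{u}) : Prop :=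
  ∀ x : X, IsDomain (X.presheaf.stalk x) ∧ IsIntegrallyClosed (X.presheaf.stalk x)

/-- Relative dimension one: every nonempty fibre is one-dimensional. -/
def HasCurveFibers {X S : Scheme.{u}} (f : X ⟶ S) : Prop :=
  ∀ s : S, Nonempty (f.fiber s) → topologicalKrullDim (f.fiber s) = 1

/-- The ring `R_U` of rational functions on `X` that are regular at every point of `U`, where a
rational function is regular at `x` if it lies in (the image of) the local ring at `x`. -/
noncomputable def regularOn (X : Scheme.{u}) [IsIntegral X] (U : Set X) :
    Subring X.functionField :=
  ⨅ x ∈ U, (algebraMap (X.presheaf.stalk x) X.functionField).range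

/-- The canonical ring homomorphism from `R` to the function field of an integral `R`-scheme. -/
noncomputable def toFunctionField {R : Type u} [CommRing R] {X : Scheme.{u}} [IsIntegral X]
    (f : X ⟶ Spec (CommRingCat.of R)) : R →+* X.functionField :=
  ((Scheme.ΓSpecIso (CommRingCat.of R)).inv ≫ f.appTop ≫
    X.presheaf.germ ⊤ (genericPoint X) trivial).hom

theorem toFunctionField_mem {R : Type u} [CommRing R] {X : Scheme.{u}} [IsIntegral X]
    (f : X ⟶ Spec (CommRingCat.of R)) (U : Set X) (r : R) :
    toFunctionField f r ∈ regularOn X U := by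
  simp only [regularOn, Subring.mem_iInf]
  intro x _
  exact ⟨X.presheaf.germ ⊤ x trivial
    (((Scheme.ΓSpecIso (CommRingCat.of R)).inv ≫ f.appTop).hom r), by
    have : Nonempty (⊤ : X.Opens) := ⟨⟨genericPoint X, trivial⟩⟩
    exact Scheme.algebraMap_germ_eq_germToFunctionField X (U := ⊤) (x := x) trivial _⟩

/-- The canonical ring homomorphism `R → R_U`. -/
noncomputable def toRegularOn {R : Type u} [CommRing R] {X : Scheme.{u}} [IsIntegral X]
    (f : X ⟶ Spec (CommRingCat.of R)) (U : Set X) : R →+* regularOn X U :=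
  (toFunctionField f).codRestrict (regularOn X U) (toFunctionField_mem f U)

/-- The `𝔪_R R_U`-adic completion of `R_U`. -/
abbrev completedRegularOn {R : Type u} [CommRing R] [IsLocalRing R] {X : Scheme.{u}}
    [IsIntegral X] (f : X ⟶ Spec (CommRingCat.of R)) (U : Set X) : Type u :=
  AdicCompletion ((IsLocalRing.maximalIdeal R).map (toRegularOn f U)) (regularOn X U)

end WeierstrassCurve32

namespace WeierstrassCurve32

open scoped Pointwise

/-! ### Krull–Akizuki for one-dimensional noetherian domains -/

section KrullAkizuki

/-! Write `m` for the maximal ideal of `R`, `A` for `R_U`, `B` for its completion, and `S` for the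
coordinate ring of an affine open containing `U`. Then `S` is a normal noetherian domain of
dimension at most two, and `A` is the intersection of the localisations of `S` at the points of `U`.
Since `A` is given only as an intersection, even its noetherianity needs an argument.

The structure of `A` is controlled by the primes `P S_P ∩ A`, for `P` a height-one prime of `S`
below a point of `U`: every nonzero prime of `A` contains one of them. Each quotient `A/(P S_P ∩ A)`
lies between the domain `S/P`, of dimension at most one, and its fraction field, so Krull–Akizuki
makes it noetherian with proper quotients finite over `S`. Filtering the torsion of `F/A` by primes
of `S` then shows that `A` is noetherian. Moreover `A/p` is finite over `R` for every nonzero prime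
`p` not containing `m`: it is finite modulo `m` and `m`-adically separated, and `R` is complete.
These facts are collected in `IsRegularRing`.

Part (1): `A/p` is `m`-adically complete, being either killed by `m` or finite over `R`. Exactness
of completion on finite modules gives `B/pB = A/p`.

Part (2) follows from (1) once `q = Q ∩ A` is nonzero, because `A` then surjects onto `B/qB`.
Suppose `Q` is non-minimal and `q = 0`. By Krull's principal ideal theorem no prime over `Q + mB` is
minimal over a nonzero `t ∈ m`, so each contracts to a prime of `A` strictly above another prime
containing `m`, and its residue ring is finite over `R`. Hence `B/(Q + mB)`, then `B/Q`, then its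
subring `A` are finite over `R`. Integrality now forbids strict inclusions between primes over `m`,
a contradiction (`IsRegularRing.comap_ne_bot`).

Part (3) adds that nonzero elements of `A` stay regular in `B`, by flatness. -/

theorem isArtinianRing_quotient_span_singleton {D : Type*} [CommRing D] [IsDomain D]
    [IsNoetherianRing D] (hdim : ∀ P : Ideal D, P.IsPrime → P ≠ ⊥ → P.IsMaximal)
    {I : Ideal D} (hI : I ≠ ⊥) : IsArtinianRing (D ⧸ I) := by
  rw [isArtinianRing_iff_krullDimLE_zero]
  refine Ring.KrullDimLE.mk₀ fun J hJ => ?_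
  have h1 : (J.comap (Ideal.Quotient.mk I)).IsMaximal := by
    refine hdim _ inferInstance fun h => hI (le_bot_iff.1 ?_)
    rw [← h]
    intro x hx
    simp [Ideal.mem_comap, Ideal.Quotient.eq_zero_iff_mem.2 hx]
  have := Ideal.map_eq_top_or_isMaximal_of_surjective (Ideal.Quotient.mk I)
    Ideal.Quotient.mk_surjective h1
  rw [Ideal.map_comap_of_surjective _ Ideal.Quotient.mk_surjective] at this
  exact this.resolve_left hJ.ne_top

theorem length_quotient_ne_top {D : Type*} [CommRing D] [IsDomain D]
    [IsNoetherianRing D] (hdim : ∀ P : Ideal D, P.IsPrime → P ≠ ⊥ → P.IsMaximal)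
    {I : Ideal D} (hI : I ≠ ⊥) : Module.length D (D ⧸ I) ≠ ⊤ := by
  have := isArtinianRing_quotient_span_singleton hdim hI
  rw [Module.length_eq_of_surjective (R := D ⧸ I) (S := D) (M := D ⧸ I)
    Ideal.Quotient.mk_surjective]
  exact Module.length_ne_top

/-- The length of `J / aJ` is at most that of `D / aD`. -/
theorem length_le_of_map_le {D : Type*} [CommRing D] [IsDomain D]
    [IsNoetherianRing D] (hdim : ∀ P : Ideal D, P.IsPrime → P ≠ ⊥ → P.IsMaximal)
    {a : D} (ha : a ≠ 0) (J : Ideal D) {M : Type*} [AddCommGroup M] [Module D M]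
    (g : J →ₗ[D] M) (hg : Function.Surjective g) (hga : ∀ x : J, g (a • x) = 0) :
    Module.length D M ≤ Module.length D (D ⧸ Ideal.span {a}) := by
  by_cases hJ : J = ⊥
  · subst hJ
    have : Subsingleton M := hg.subsingleton
    simp
  -- The length of `D/aJ` is computed twice: through multiplication by `a`, with pieces `D/J` and
  -- `D/aD`, and through `J/aJ`, with pieces `J/aJ` and `D/J`. The finite length of `D/J` cancels.
  have e1 := Module.length_eq_add_of_exact (Ideal.mulQuot a J) (Ideal.quotOfMul a J)
    (Ideal.mulQuot_injective J (mem_nonZeroDivisors_of_ne_zero ha))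
    (Ideal.quotOfMul_surjective J) (Ideal.exact_mulQuot_quotOfMul J)
  have hle : a • J ≤ J := Submodule.smul_le_self_of_tower a J
  let K : Submodule D (D ⧸ a • J) := LinearMap.ker (Submodule.factor hle)
  have e2 := Module.length_eq_add_of_exact K.subtype (Submodule.factor hle)
    (Submodule.subtype_injective _) (Submodule.factor_surjective hle)
    (LinearMap.exact_subtype_ker_map _)
  have hJa : Module.length D (D ⧸ J) ≠ ⊤ := length_quotient_ne_top hdim hJ
  have e3 : Module.length D M ≤ Module.length D K := by
    let h : J →ₗ[D] K := ((a • J).mkQ.comp J.subtype).codRestrict K (fun x => by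
      simp [K, Ideal.Quotient.eq_zero_iff_mem])
    have hh : Function.Surjective h := by
      rintro ⟨y, hy⟩
      obtain ⟨y, rfl⟩ := Submodule.mkQ_surjective _ y
      refine ⟨⟨y, ?_⟩, rfl⟩
      simpa [K, Ideal.Quotient.eq_zero_iff_mem] using hy
    have hk : LinearMap.ker h ≤ LinearMap.ker g := by
      rintro ⟨x, hx⟩ hx'
      have h1 : x ∈ a • J := by
        have : (a • J).mkQ x = 0 := congrArg Subtype.val (LinearMap.mem_ker.1 hx')
        rwa [Submodule.mkQ_apply, Submodule.Quotient.mk_eq_zero] at this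
      obtain ⟨z, hz, hzx⟩ := h1
      have : (⟨x, hx⟩ : J) = a • ⟨z, hz⟩ := Subtype.ext (by simpa using hzx.symm)
      rw [LinearMap.mem_ker, this, hga]
    refine Module.length_le_of_surjective
      ((LinearMap.ker h).liftQ g hk ∘ₗ (h.quotKerEquivOfSurjective hh).symm.toLinearMap) ?_
    intro m
    obtain ⟨x, rfl⟩ := hg m
    have hx : (h.quotKerEquivOfSurjective hh).symm (h x) = Submodule.Quotient.mk x := by
      rw [LinearEquiv.symm_apply_eq]
      rfl
    refine ⟨h x, ?_⟩
    rw [LinearMap.comp_apply, LinearEquiv.coe_coe, hx]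
    rfl
  rw [e1, add_comm] at e2
  exact e3.trans (ENat.add_le_add_iff_right hJa |>.1 e2.ge)

/-- The finiteness statement at the heart of the Krull–Akizuki theorem. -/
theorem finite_quotient_of_fractions {D C : Type*} [CommRing D] [IsDomain D] [IsNoetherianRing D]
    (hdim : ∀ P : Ideal D, P.IsPrime → P ≠ ⊥ → P.IsMaximal) [CommRing C] [IsDomain C]
    [Algebra D C] (hinj : Function.Injective (algebraMap D C))
    (hfrac : ∀ c : C, ∃ d : D, d ≠ 0 ∧ ∃ e, algebraMap D C d * c = algebraMap D C e)
    {a : D} (ha : a ≠ 0) : Module.Finite D (C ⧸ Ideal.span {algebraMap D C a}) := by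
  classical
  set I : Ideal C := Ideal.span {algebraMap D C a} with hI
  let M := C ⧸ I
  have hden : ∀ s : Finset C, ∃ d : D, d ≠ 0 ∧ ∀ c ∈ s, ∃ e,
      algebraMap D C d * c = algebraMap D C e := by
    intro s
    induction s using Finset.induction_on with
    | empty => exact ⟨1, one_ne_zero, by simp⟩
    | insert c s _ ih =>
      obtain ⟨d, hd, h⟩ := ih
      obtain ⟨d', hd', e', h'⟩ := hfrac c
      refine ⟨d * d', mul_ne_zero hd hd', fun x hx => ?_⟩
      rcases Finset.mem_insert.1 hx with rfl | hx
      · exact ⟨d * e', by rw [map_mul, map_mul, mul_assoc, h']⟩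
      · obtain ⟨e, he⟩ := h x hx
        exact ⟨d' * e, by rw [map_mul, map_mul, mul_right_comm, he, mul_comm]⟩
  -- A common denominator `d` turns a finitely generated `N ⊆ C` into an ideal `J = dN` of `D`. The
  -- image of `N` in `C/aC` is then a quotient of `J/aJ`, so its length is bounded independently of
  -- `N`.
  have key : ∀ s : Finset C, Module.length D
      ((Submodule.span D (s : Set C)).map (I.restrictScalars D).mkQ) ≤
        Module.length D (D ⧸ Ideal.span {a}) := by
    intro s
    obtain ⟨d, hd, hs⟩ := hden s
    let N := Submodule.span D (s : Set C)
    let ι := Algebra.linearMap D C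
    let J : Ideal D := (N.map (LinearMap.mulLeft D (algebraMap D C d))).comap ι
    have hdC : algebraMap D C d ≠ 0 := fun h => hd (hinj (by simpa using h))
    have hN : ∀ c ∈ N, ∃ e, algebraMap D C d * c = algebraMap D C e := by
      intro c hc
      have : N ≤ (LinearMap.range ι).comap (LinearMap.mulLeft D (algebraMap D C d)) := by
        refine Submodule.span_le.2 fun c hc => ?_
        obtain ⟨e, he⟩ := hs c hc
        exact ⟨e, by simpa [ι] using he.symm⟩
      obtain ⟨e, he⟩ := this hc
      exact ⟨e, by simpa [ι] using he.symm⟩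
    have hJ : ∀ j : J, ∃ c : N, algebraMap D C d * c = algebraMap D C j := by
      rintro ⟨j, hj⟩
      obtain ⟨c, hc, h⟩ := hj
      exact ⟨⟨c, hc⟩, by simpa [ι] using h⟩
    choose f hf using hJ
    let φ : J →ₗ[D] N :=
      { toFun := f
        map_add' := fun x y => Subtype.ext (mul_left_cancel₀ hdC (by
          simp only [Submodule.coe_add, mul_add, hf, map_add]))
        map_smul' := fun r x => Subtype.ext (mul_left_cancel₀ hdC (by
          simp only [Submodule.coe_smul, Algebra.smul_def, RingHom.id_apply, hf, map_mul,
            mul_left_comm _ (algebraMap D C r), Algebra.algebraMap_self_apply])) }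
    have hφ : Function.Surjective φ := by
      rintro ⟨c, hc⟩
      obtain ⟨e, he⟩ := hN c hc
      refine ⟨⟨e, c, hc, by simpa [ι] using he⟩, Subtype.ext (mul_left_cancel₀ hdC ?_)⟩
      exact (hf _).trans he.symm
    let g : N →ₗ[D] N.map (I.restrictScalars D).mkQ :=
      (I.restrictScalars D).mkQ.submoduleMap N
    have hgs : Function.Surjective g := LinearMap.submoduleMap_surjective _ _
    refine length_le_of_map_le hdim ha J (g ∘ₗ φ) (hgs.comp hφ) fun x => ?_
    rw [map_smul]
    refine Subtype.ext ?_
    obtain ⟨c, hc⟩ := hgs ((g (φ x)))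
    change a • (I.restrictScalars D).mkQ (φ x : C) = 0
    rw [← map_smul, Submodule.mkQ_apply, Submodule.Quotient.mk_eq_zero,
      Submodule.restrictScalars_mem, Algebra.smul_def]
    exact Ideal.mul_mem_right _ _ (Ideal.mem_span_singleton_self _)
  have hfin : Module.length D (D ⧸ Ideal.span {a}) ≠ ⊤ :=
    length_quotient_ne_top hdim (by simpa using ha)
  suffices h : Module.Finite D (C ⧸ I.restrictScalars D) from h
  let L : Finset C → ℕ∞ := fun s =>
    Module.length D ((Submodule.span D (s : Set C)).map (I.restrictScalars D).mkQ)
  obtain ⟨m, hm⟩ := ENat.ne_top_iff_exists.1 hfin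
  have hL : ∀ s, (L s).toNat ≤ m := fun s => by
    have := key s
    rw [← hm] at this
    exact ENat.toNat_le_of_le_natCast this
  -- A finite set whose image has maximal length must generate: adjoining one more element cannot
  -- enlarge the image. All lengths are finite, so `toNat` loses nothing.
  obtain ⟨s, hs⟩ : ∃ s, ∀ t, (L t).toNat ≤ (L s).toNat := by
    have hb : BddAbove (Set.range fun s => (L s).toNat) := ⟨m, by rintro _ ⟨s, rfl⟩; exact hL s⟩
    obtain ⟨s, hs⟩ := Nat.sSup_mem (Set.range_nonempty _) hb
    exact ⟨s, fun t => by
      simp only at hs; rw [hs]; exact le_csSup hb ⟨t, rfl⟩⟩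
  refine ⟨⟨s.image (I.restrictScalars D).mkQ, ?_⟩⟩
  rw [Finset.coe_image, ← Submodule.map_span]
  refine eq_top_iff.2 fun y _ => ?_
  obtain ⟨c, rfl⟩ := Submodule.mkQ_surjective _ y
  let N₁ := (Submodule.span D (s : Set C)).map (I.restrictScalars D).mkQ
  let N₂ := (Submodule.span D ((insert c s : Finset C) : Set C)).map (I.restrictScalars D).mkQ
  have h12 : N₁ ≤ N₂ := Submodule.map_mono (Submodule.span_mono (by simp))
  by_contra hc
  have hlt : (N₁.submoduleOf N₂) ≠ ⊤ := by
    intro h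
    rw [Submodule.submoduleOf_eq_top] at h
    exact hc (h ⟨c, Submodule.subset_span (by simp), rfl⟩)
  have hne : Module.length D N₂ ≠ ⊤ := ne_top_of_le_ne_top hfin (key _)
  have hfl := Module.length_ne_top_iff.1 hne
  have := (isFiniteLength_iff_isNoetherian_isArtinian.1 hfl).1
  have := (isFiniteLength_iff_isNoetherian_isArtinian.1 hfl).2
  have h1 := Submodule.length_lt hlt
  rw [(Submodule.submoduleOfEquivOfLe h12).length_eq] at h1
  have h2 := hs (insert c s)
  refine absurd h1 (not_lt.2 ?_)
  rw [← ENat.natCast_toNat hne, ← ENat.natCast_toNat (ne_top_of_le_ne_top hfin (key s))]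
  exact_mod_cast h2

theorem fg_of_isNoetherian_quotient_span {C : Type*} [CommRing C] {I : Ideal C} {c : C}
    (hc : c ∈ I) [IsNoetherian C (C ⧸ Ideal.span {c})] : I.FG := by
  refine Submodule.fg_of_fg_map_of_fg_inf_ker
    (Ideal.Quotient.mkₐ C (Ideal.span {c})).toLinearMap (IsNoetherian.noetherian _) ?_
  have : LinearMap.ker (Ideal.Quotient.mkₐ C (Ideal.span {c})).toLinearMap = Ideal.span {c} := by
    ext x
    simp [Ideal.Quotient.eq_zero_iff_mem]
  rw [this, inf_eq_right.2 (by simpa [Ideal.span_le] using hc)]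
  exact ⟨{c}, by simp⟩

variable {S C : Type*} [CommRing S] [IsNoetherianRing S] [CommRing C] [IsDomain C] [Algebra S C]

/-- `C` is birational over the image of `S`, and this image has dimension at most one. -/
structure IsOneDimOverring (S C : Type*) [CommRing S] [CommRing C] [Algebra S C] : Prop where
  isMaximal : ∀ P : Ideal S, P.IsPrime → RingHom.ker (algebraMap S C) < P → P.IsMaximal
  exists_mul_eq : ∀ c : C, ∃ s : S, algebraMap S C s ≠ 0 ∧
    ∃ e, algebraMap S C s * c = algebraMap S C e

namespace IsOneDimOverring

theorem finite_quotient_span (h : IsOneDimOverring S C) {a : S} (ha : algebraMap S C a ≠ 0) :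
    Module.Finite S (C ⧸ Ideal.span {algebraMap S C a}) := by
  let k := RingHom.ker (algebraMap S C)
  let D := S ⧸ k
  have hk : k.IsPrime := RingHom.ker_isPrime _
  let : Algebra D C := (RingHom.kerLift (algebraMap S C)).toAlgebra
  have hD : ∀ s : S, algebraMap D C (Ideal.Quotient.mk k s) = algebraMap S C s := fun s => rfl
  have : IsScalarTower S D C := IsScalarTower.of_algebraMap_eq fun s => (hD s).symm
  have hinj : Function.Injective (algebraMap D C) := RingHom.kerLift_injective _
  have hdim : ∀ P : Ideal D, P.IsPrime → P ≠ ⊥ → P.IsMaximal := by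
    intro P hP hP0
    have h1 : (P.comap (Ideal.Quotient.mk k)).IsMaximal := by
      refine h.isMaximal _ inferInstance (lt_of_le_of_ne ?_ ?_)
      · intro x hx
        rw [Ideal.mem_comap, Ideal.Quotient.eq_zero_iff_mem.2 hx]
        exact P.zero_mem
      · intro h
        apply hP0
        rw [← Ideal.map_comap_of_surjective _ Ideal.Quotient.mk_surjective P, ← h]
        exact Ideal.map_quotient_self k
    have := Ideal.map_eq_top_or_isMaximal_of_surjective (Ideal.Quotient.mk k)
      Ideal.Quotient.mk_surjective h1
    rw [Ideal.map_comap_of_surjective _ Ideal.Quotient.mk_surjective] at this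
    exact this.resolve_left hP.ne_top
  have hfrac : ∀ c : C, ∃ d : D, d ≠ 0 ∧ ∃ e, algebraMap D C d * c = algebraMap D C e := by
    intro c
    obtain ⟨s, hs, e, he⟩ := h.exists_mul_eq c
    refine ⟨Ideal.Quotient.mk k s, fun h0 => hs ?_, Ideal.Quotient.mk k e, he⟩
    rw [← hD, h0, map_zero]
  have ha' : (Ideal.Quotient.mk k a) ≠ 0 := fun h0 => ha (by rw [← hD, h0, map_zero])
  have := finite_quotient_of_fractions hdim hinj hfrac ha'
  rw [hD] at this
  exact Module.Finite.trans D _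

/-- Clearing the denominator of a nonzero element of `I` gives a nonzero element of `I` coming from
`S`, which reduces to the principal case. -/
theorem finite_quotient (h : IsOneDimOverring S C) {I : Ideal C} (hI : I ≠ ⊥) :
    ∃ a : S, algebraMap S C a ≠ 0 ∧ algebraMap S C a ∈ I ∧ Module.Finite S (C ⧸ I) := by
  obtain ⟨c, hc, hc0⟩ := Submodule.exists_mem_ne_zero_of_ne_bot hI
  obtain ⟨s, hs, e, he⟩ := h.exists_mul_eq c
  have he0 : algebraMap S C e ≠ 0 := he ▸ mul_ne_zero hs hc0
  have heI : algebraMap S C e ∈ I := he ▸ I.mul_mem_left _ hc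
  have := h.finite_quotient_span he0
  have hle : Ideal.span {algebraMap S C e} ≤ I := by simpa [Ideal.span_le] using heI
  exact ⟨e, he0, heI, Module.Finite.of_surjective
    ((Ideal.Quotient.factorₐ S hle).toLinearMap) (Ideal.Quotient.factor_surjective hle)⟩

theorem isNoetherianRing (h : IsOneDimOverring S C) : IsNoetherianRing C := by
  rw [isNoetherianRing_iff_ideal_fg]
  intro I
  by_cases hI : I = ⊥
  · exact hI ▸ Submodule.fg_bot
  obtain ⟨a, ha0, haI, -⟩ := h.finite_quotient hI
  have := h.finite_quotient_span ha0
  set J := Ideal.span {algebraMap S C a} with hJ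
  have hn : IsNoetherian S (C ⧸ J) := isNoetherian_of_isNoetherianRing_of_finite _ _
  have : IsNoetherian C (C ⧸ J) := isNoetherian_of_tower S hn
  exact fg_of_isNoetherian_quotient_span haI

/-- `C/q` is finite, hence integral, over `S`, and `q` contracts to a maximal ideal of `S`. -/
theorem isMaximal_of_ne_bot (h : IsOneDimOverring S C) {q : Ideal C} [q.IsPrime] (hq : q ≠ ⊥) :
    q.IsMaximal := by
  obtain ⟨a, ha0, haq, hfin⟩ := h.finite_quotient hq
  have hmax : (q.comap (algebraMap S C)).IsMaximal := by
    refine h.isMaximal _ inferInstance (lt_of_le_of_ne (fun x hx => ?_) fun heq => ha0 ?_)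
    · rw [Ideal.mem_comap, (RingHom.mem_ker).1 hx]
      exact q.zero_mem
    · have : a ∈ q.comap (algebraMap S C) := haq
      rwa [← heq] at this
  have hint : (algebraMap S (C ⧸ q)).IsIntegral := 
    (algebraMap_isIntegral_iff.2 inferInstance)
  have hbot : (⊥ : Ideal (C ⧸ q)).IsMaximal := by
    refine Ideal.isMaximal_of_isIntegral_of_isMaximal_comap' _ hint ⊥ ?_
    convert hmax using 1
    ext x
    rw [Ideal.mem_comap, Ideal.mem_bot, Ideal.mem_comap, IsScalarTower.algebraMap_apply S C (C ⧸ q)]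
    exact Ideal.Quotient.eq_zero_iff_mem
  exact Ideal.Quotient.maximal_of_isField _ (by
    exact Ring.isField_iff_maximal_bot.2 hbot)

end IsOneDimOverring

end KrullAkizuki

/-! ### Height-one primes of normal noetherian domains -/

section DivisorialPrimes

variable {S : Type*} [CommRing S]

/-- A nonzero prime ideal `P` whose localisation is principal; the last clause says that
`P S_P` is generated by `π`. -/
structure IsDivisorial (P : Ideal S) : Prop where
  isPrime : P.IsPrime
  ne_bot : P ≠ ⊥
  exists_generator : ∃ π ∈ P, ∃ v ∉ P, ∀ c ∈ P, ∃ d, v * c = d * π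

variable [IsDomain S] [IsNoetherianRing S] [IsIntegrallyClosed S]

/-- Determinant trick: `x` stabilises the finitely generated nonzero module `P`, so it is integral
over `S`. -/
theorem mem_range_of_mul_mem {F : Type*} [Field F] [Algebra S F] [IsFractionRing S F]
    {P : Ideal S} (hP : P ≠ ⊥) (x : F)
    (hx : ∀ c ∈ P, ∃ d ∈ P, algebraMap S F c * x = algebraMap S F d) :
    ∃ e, algebraMap S F e = x := by
  refine IsIntegrallyClosed.isIntegral_iff.1
    (isIntegral_of_smul_mem_submodule (Submodule.map (Algebra.linearMap S F) P) ?_ ?_ x ?_)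
  · obtain ⟨c, hc, hc0⟩ := Submodule.exists_mem_ne_zero_of_ne_bot hP
    refine fun h => hc0 (IsFractionRing.injective S F ?_)
    have : algebraMap S F c ∈ Submodule.map (Algebra.linearMap S F) P := ⟨c, hc, rfl⟩
    rw [h] at this
    simpa using this
  · exact (IsNoetherian.noetherian P).map _
  · rintro _ ⟨c, hc, rfl⟩
    obtain ⟨d, hd, h⟩ := hx c hc
    exact ⟨d, hd, by simp [← h, mul_comm]⟩

theorem IsDivisorial.eq_of_le {P Q : Ideal S} (hP : IsDivisorial P) [hQ : Q.IsPrime] (hQ0 : Q ≠ ⊥)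
    (hle : Q ≤ P) : Q = P := by
  obtain ⟨π, hπ, v, hv, h⟩ := hP.exists_generator
  have hvQ : v ∉ Q := fun h => hv (hle h)
  by_cases hπQ : π ∈ Q
  · refine le_antisymm hle fun c hc => ?_
    obtain ⟨d, hd⟩ := h c hc
    exact (hQ.mem_or_mem (hd ▸ Q.mul_mem_left d hπQ : v * c ∈ Q)).resolve_left hvQ
  -- If `π ∉ Q`, multiplication by `v/π` carries `Q` into itself, so `v/π` lies in `S` and `v ∈ πS ⊆
  -- P`.
  · exfalso
    let F := FractionRing S
    have hπ0 : algebraMap S F π ≠ 0 := fun h0 => hπQ (by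
      have : π = 0 := IsFractionRing.injective S F (by simpa using h0)
      exact this ▸ Q.zero_mem)
    obtain ⟨e, he⟩ := mem_range_of_mul_mem hQ0 (algebraMap S F v / algebraMap S F π) (by
      intro c hc
      obtain ⟨d, hd⟩ := h c (hle hc)
      refine ⟨d, (hQ.mem_or_mem (hd ▸ Q.mul_mem_left v hc : d * π ∈ Q)).resolve_right hπQ, ?_⟩
      rw [mul_div_assoc', div_eq_iff hπ0, ← map_mul, ← map_mul, mul_comm c, hd])
    rw [eq_div_iff hπ0, ← map_mul] at he
    exact hv (IsFractionRing.injective S F he ▸ P.mul_mem_left e hπ)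

/-- A normal noetherian domain is the intersection of its localisations at divisorial primes. -/
theorem exists_isDivisorial {F : Type*} [Field F] [Algebra S F] [IsFractionRing S F] {w : F}
    {y : Ideal S} [y.IsPrime] (hw : ∀ s ∉ y, ∀ r, algebraMap S F s * w ≠ algebraMap S F r) :
    ∃ P : Ideal S, IsDivisorial P ∧ P ≤ y ∧
      ∀ s r, algebraMap S F s * w = algebraMap S F r → s ∈ P := by
  let N : Submodule S F := LinearMap.range (Algebra.linearMap S F)
  have hN : ∀ (x : F) c, c ∈ N.colon {x} ↔ ∃ r, algebraMap S F c * x = algebraMap S F r := by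
    intro x c
    rw [Submodule.mem_colon_singleton, Algebra.smul_def]
    exact ⟨fun ⟨r, hr⟩ => ⟨r, hr.symm⟩, fun ⟨r, hr⟩ => ⟨r, hr.symm⟩⟩
  have hle : N.colon {w} ≤ y := by
    intro c hc
    obtain ⟨r, hr⟩ := (hN w c).1 hc
    by_contra hcy
    exact hw c hcy r hr
  -- A prime minimal over the denominator ideal of `w` is associated to `F/S`, hence is itself the
  -- denominator ideal of some `x`.
  obtain ⟨P, hPmin, hPy⟩ := Ideal.exists_minimalPrimes_le hle
  have hPp : P.IsPrime := hPmin.1.1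
  obtain ⟨x, hx⟩ := Submodule.exists_eq_colon_of_mem_minimalPrimes hPmin
  have hwP : ∀ s r, algebraMap S F s * w = algebraMap S F r → s ∈ P := fun s r h =>
    hPmin.1.2 ((hN w s).2 ⟨r, h⟩)
  have hP0 : P ≠ ⊥ := by
    rintro rfl
    obtain ⟨⟨r, ⟨s, hs⟩⟩, h⟩ := IsLocalization.surj (nonZeroDivisors S) w
    exact nonZeroDivisors.ne_zero hs (by simpa using hwP s r (by simpa [mul_comm] using h))
  have hPx : ∀ c, c ∈ P ↔ ∃ r, algebraMap S F c * x = algebraMap S F r := fun c => by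
    rw [← hN, ← hx]
  refine ⟨P, ⟨hPp, hP0, ?_⟩, hPy, hwP⟩
  -- If `xP ⊆ P`, then `x` would be integral, so in `S`, and `1 ∈ P`. Hence `x = v/π` with `π ∈ P`
  -- and `v ∉ P`, and `xP ⊆ S` says that `π` generates `P` locally.
  have : ∃ c ∈ P, ∃ v ∉ P, algebraMap S F c * x = algebraMap S F v := by
    by_contra! hcon
    obtain ⟨e, rfl⟩ := mem_range_of_mul_mem hP0 x fun c hc => by
      obtain ⟨r, hr⟩ := (hPx c).1 hc
      refine ⟨r, ?_, hr⟩
      by_contra hrP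
      exact hcon c hc r hrP hr
    exact hPp.ne_top ((Ideal.eq_top_iff_one _).2 ((hPx 1).2 ⟨e, by simp⟩))
  obtain ⟨π, hπ, v, hv, h⟩ := this
  refine ⟨π, hπ, v, hv, fun c hc => ?_⟩
  obtain ⟨d, hd⟩ := (hPx c).1 hc
  refine ⟨d, IsFractionRing.injective S F ?_⟩
  rw [map_mul, map_mul, ← h, ← hd]
  ring

end DivisorialPrimes

/-! ### Contracting the maximal ideal of a localisation -/

section Contraction

variable {S A : Type*} [CommRing S] [CommRing A] [Algebra S A]

/-- `A` is contained in the localisation of `S` at `P`. -/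
def IsFractionalAt (A : Type*) [CommRing A] [Algebra S A] (P : Ideal S) : Prop :=
  ∀ a : A, ∃ s ∉ P, ∃ r, algebraMap S A s * a = algebraMap S A r

/-- The ideal `P S_P ∩ A` of `A`. -/
def localContraction (P : Ideal S) [hP : P.IsPrime] (h : IsFractionalAt A P) : Ideal A where
  carrier := {a | ∃ s ∉ P, ∃ r ∈ P, algebraMap S A s * a = algebraMap S A r}
  zero_mem' := ⟨1, hP.one_notMem, 0, P.zero_mem, by simp⟩
  add_mem' := by
    rintro a b ⟨s, hs, r, hr, h⟩ ⟨s', hs', r', hr', h'⟩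
    refine ⟨s * s', hP.mul_notMem hs hs', s' * r + s * r',
      P.add_mem (P.mul_mem_left _ hr) (P.mul_mem_left _ hr'), ?_⟩
    simp only [map_mul, map_add, ← h, ← h']
    ring
  smul_mem' := by
    rintro c a ⟨s, hs, r, hr, h₁⟩
    obtain ⟨s', hs', r', h₂⟩ := h c
    refine ⟨s * s', hP.mul_notMem hs hs', r' * r, P.mul_mem_left _ hr, ?_⟩
    simp only [map_mul, ← h₁, ← h₂, smul_eq_mul]
    ring

variable (hinj : Function.Injective (algebraMap S A)) {P : Ideal S} [hP : P.IsPrime]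
  (h : IsFractionalAt A P)

include hinj

/-- Membership may be tested on any one fraction representing `a`. -/
theorem mem_localContraction_iff_of_mul_eq {a : A} {s r : S} (hs : s ∉ P)
    (hsr : algebraMap S A s * a = algebraMap S A r) : a ∈ localContraction P h ↔ r ∈ P := by
  refine ⟨fun ⟨s', hs', r', hr', h'⟩ => ?_, fun hr => ⟨s, hs, r, hr, hsr⟩⟩
  have : s' * r = s * r' := hinj (by
    rw [map_mul, map_mul, ← hsr, ← h']
    ring)
  exact (hP.mem_or_mem (this ▸ P.mul_mem_left s hr' : s' * r ∈ P)).resolve_left hs'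

theorem isPrime_localContraction : (localContraction P h).IsPrime := by
  refine ⟨fun htop => ?_, fun {a b} hab => ?_⟩
  · have h1 : (1 : A) ∈ localContraction P h := htop ▸ Submodule.mem_top
    rw [mem_localContraction_iff_of_mul_eq hinj h hP.one_notMem (r := 1) (by simp)] at h1
    exact hP.one_notMem h1
  · obtain ⟨s, hs, r, hr⟩ := h a
    obtain ⟨s', hs', r', hr'⟩ := h b
    rw [mem_localContraction_iff_of_mul_eq hinj h (hP.mul_notMem hs hs') (r := r * r') (by
      rw [map_mul, map_mul, ← hr, ← hr']
      ring)] at hab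
    rw [mem_localContraction_iff_of_mul_eq hinj h hs hr,
      mem_localContraction_iff_of_mul_eq hinj h hs' hr']
    exact hP.mem_or_mem hab

theorem comap_localContraction : (localContraction P h).comap (algebraMap S A) = P := by
  ext x
  rw [Ideal.mem_comap, mem_localContraction_iff_of_mul_eq hinj h hP.one_notMem (r := x) (by simp)]

theorem localContraction_mono {Q : Ideal S} [Q.IsPrime] (hQ : IsFractionalAt A Q) (hle : P ≤ Q) :
    localContraction P h ≤ localContraction Q hQ := by
  intro a ha
  obtain ⟨s, hs, r, hr⟩ := hQ a
  have hsP : s ∉ P := fun h => hs (hle h)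
  rw [mem_localContraction_iff_of_mul_eq hinj h hsP hr] at ha
  exact ⟨s, hs, r, hle ha, hr⟩

/-- The quotient sits between `S/P` and its fraction field; this is where Krull–Akizuki becomes
available for `A`. -/
theorem isOneDimOverring_quotient_localContraction
    (hdim : ∀ Q : Ideal S, Q.IsPrime → P < Q → Q.IsMaximal) :
    IsOneDimOverring S (A ⧸ localContraction P h) := by
  have hmem : ∀ s, algebraMap S (A ⧸ localContraction P h) s = 0 ↔ s ∈ P := fun s => by
    rw [IsScalarTower.algebraMap_apply S A, Ideal.Quotient.algebraMap_eq,
      Ideal.Quotient.eq_zero_iff_mem, ← Ideal.mem_comap, comap_localContraction hinj h]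
  refine ⟨fun Q hQ hlt => hdim Q hQ ?_, fun c => ?_⟩
  · convert hlt using 1
    ext s
    rw [RingHom.mem_ker, hmem]
  · obtain ⟨a, rfl⟩ := Ideal.Quotient.mk_surjective c
    obtain ⟨s, hs, r, hr⟩ := h a
    refine ⟨s, fun h0 => hs ((hmem s).1 h0), r, ?_⟩
    rw [IsScalarTower.algebraMap_apply S A (A ⧸ localContraction P h) s,
      IsScalarTower.algebraMap_apply S A (A ⧸ localContraction P h) r,
      Ideal.Quotient.algebraMap_eq, ← map_mul, hr]

end Contraction

/-! ### Intersections of localisations are noetherian -/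

section Overring

/-- `A` is, inside `F`, the intersection of the localisations of `S` at the primes in `𝒰`. -/
structure IsIntersectionOfLocalizations (S A F : Type*) [CommRing S] [CommRing A] [Field F]
    [Algebra S F] [Algebra A F] (𝒰 : Set (Ideal S)) : Prop where
  isPrime : ∀ y ∈ 𝒰, y.IsPrime
  mem_iff : ∀ x : F, (∃ a, algebraMap A F a = x) ↔
    ∀ y ∈ 𝒰, ∃ s ∉ y, ∃ r, algebraMap S F s * x = algebraMap S F r

/-- `M` is a quotient of `N/ker φ`, which embeds in `L`; so subquotients of `L` are handled without
constructing a map out of `M`. -/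
theorem isNoetherian_of_ker_le {A M N L : Type*} [CommRing A] [AddCommGroup M] [AddCommGroup N]
    [AddCommGroup L] [Module A M] [Module A N] [Module A L] [IsNoetherian A L]
    (φ : N →ₗ[A] L) (ψ : N →ₗ[A] M) (hψ : Function.Surjective ψ)
    (h : LinearMap.ker φ ≤ LinearMap.ker ψ) : IsNoetherian A M := by
  have : IsNoetherian A (N ⧸ LinearMap.ker φ) :=
    isNoetherian_of_injective ((LinearMap.ker φ).liftQ φ le_rfl) (by
      rw [← LinearMap.ker_eq_bot]
      exact Submodule.ker_liftQ_eq_bot _ _ _ le_rfl)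
  refine isNoetherian_of_surjective ((LinearMap.ker φ).liftQ ψ h) ?_
  rw [LinearMap.range_eq_top]
  intro m
  obtain ⟨x, rfl⟩ := hψ m
  exact ⟨Submodule.Quotient.mk x, by simp⟩

/-- The elements of an `A`-module killed by an ideal of `S`. -/
def idealTorsion {S : Type*} (A H : Type*) [CommRing S] [CommRing A] [Algebra S A]
    [AddCommGroup H] [Module A H] (I : Ideal S) : Submodule A H where
  carrier := {x | ∀ c ∈ I, algebraMap S A c • x = 0}
  zero_mem' := fun _ _ => smul_zero _
  add_mem' := fun {x y} hx hy c hc => by rw [smul_add, hx c hc, hy c hc, add_zero]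
  smul_mem' := fun a x hx c hc => by rw [smul_comm, hx c hc, smul_zero]

section

variable {S A H : Type*} [CommRing S] [CommRing A] [Algebra S A] [AddCommGroup H] [Module A H]

theorem idealTorsion_anti {I J : Ideal S} (h : I ≤ J) : idealTorsion A H J ≤ idealTorsion A H I :=
  fun _ hx c hc => hx c (h hc)

/-- Multiplication by `g ∈ J`, from the `IJ`-torsion to the `I`-torsion. -/
def idealTorsionSMul (I : Ideal S) {J : Ideal S} (g : J) :
    idealTorsion A H (I * J) →ₗ[A] idealTorsion A H I where
  toFun x := ⟨algebraMap S A g • (x : H), fun c hc => by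
    rw [smul_smul, ← map_mul]
    exact x.2 _ (Ideal.mul_mem_mul hc g.2)⟩
  map_add' _ _ := Subtype.ext (smul_add _ _ _)
  map_smul' _ _ := Subtype.ext (smul_comm _ _ _)

/-- Multiplying by finitely many generators of `J` maps the `IJ`-torsion to a finite power of the
`I`-torsion, with kernel the `J`-torsion. -/
theorem isNoetherian_idealTorsion_mul [IsNoetherianRing S] (I J : Ideal S)
    [IsNoetherian A (idealTorsion A H I)] [IsNoetherian A (idealTorsion A H J)] :
    IsNoetherian A (idealTorsion A H (I * J)) := by
  obtain ⟨G, hG⟩ := Module.Finite.fg_top (R := S) (M := J)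
  let f : idealTorsion A H (I * J) →ₗ[A] (G → idealTorsion A H I) :=
    LinearMap.pi fun g => idealTorsionSMul I (g : J)
  have hle : idealTorsion A H J ≤ idealTorsion A H (I * J) := idealTorsion_anti Ideal.mul_le_right
  refine isNoetherian_of_range_eq_ker (Submodule.inclusion hle) f ?_
  ext ⟨x, hx⟩
  rw [Submodule.range_inclusion, LinearMap.mem_ker, Submodule.mem_comap, Submodule.subtype_apply]
  constructor
  · intro h
    ext g
    exact h _ (g : J).2
  · intro h
    suffices h2 : ∀ c : J, algebraMap S A c • x = 0 from fun c hc => h2 ⟨c, hc⟩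
    intro c
    have hc : c ∈ Submodule.span S (G : Set J) := hG ▸ Submodule.mem_top
    induction hc using Submodule.span_induction with
    | mem g hg => exact congrArg Subtype.val (congrFun h ⟨g, hg⟩)
    | zero => simp
    | add a b _ _ ha hb => rw [Submodule.coe_add, map_add, add_smul, ha, hb, add_zero]
    | smul r a _ ha => rw [Submodule.coe_smul, smul_eq_mul, map_mul, mul_smul, ha, smul_zero]

end

variable {S A F : Type*} [CommRing S] [IsDomain S] [IsNoetherianRing S] [IsIntegrallyClosed S]
  [CommRing A] [Field F] [Algebra S F] [IsFractionRing S F] [Algebra A F] [FaithfulSMul A F]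
  [Algebra S A] [IsScalarTower S A F] {𝒰 : Set (Ideal S)}

namespace IsIntersectionOfLocalizations

include F in
omit [IsDomain S] [IsNoetherianRing S] [IsIntegrallyClosed S] [FaithfulSMul A F] in
theorem injective : Function.Injective (algebraMap S A) := by
  have := IsFractionRing.injective S F
  rw [IsScalarTower.algebraMap_eq S A F] at this
  exact Function.Injective.of_comp this

variable (hA : IsIntersectionOfLocalizations S A F 𝒰)

include hA

omit [IsDomain S] [IsNoetherianRing S] [IsIntegrallyClosed S] [IsFractionRing S F] in
theorem isFractionalAt {y P : Ideal S} (hy : y ∈ 𝒰) (hP : P ≤ y) : IsFractionalAt A P := by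
  intro a
  obtain ⟨s, hs, r, h⟩ := (hA.mem_iff (algebraMap A F a)).1 ⟨a, rfl⟩ y hy
  refine ⟨s, fun h => hs (hP h), r, FaithfulSMul.algebraMap_injective A F ?_⟩
  rw [map_mul, ← IsScalarTower.algebraMap_apply, ← IsScalarTower.algebraMap_apply, h]

omit [FaithfulSMul A F] [Algebra S A] [IsScalarTower S A F] in
/-- If a nonzero prime `P` multiplies `w ∉ A` into `A`, it is divisorial and `w ∉ S_P`. -/
theorem isDivisorial_of_mul_mem {w : F} {P : Ideal S} [hP : P.IsPrime] (hP0 : P ≠ ⊥)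
    (hw : ∀ c ∈ P, ∃ a, algebraMap A F a = algebraMap S F c * w)
    (hwA : ∀ a, algebraMap A F a ≠ w) :
    IsDivisorial P ∧ (∃ y ∈ 𝒰, P ≤ y) ∧
      ∀ s r, algebraMap S F s * w = algebraMap S F r → s ∈ P := by
  have h1 : ∃ y ∈ 𝒰, ∀ s ∉ y, ∀ r, algebraMap S F s * w ≠ algebraMap S F r := by
    by_contra! hcon
    obtain ⟨a, ha⟩ := (hA.mem_iff w).2 hcon
    exact hwA a ha
  obtain ⟨y, hy, hyw⟩ := h1
  have := hA.isPrime y hy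
  obtain ⟨Q, hQ, hQy, hQw⟩ := exists_isDivisorial hyw
  -- For `c ∈ P` the element `cw` lies in `A ⊆ S_y`, so `scw ∈ S` for some `s ∉ y`. Then `sc ∈ Q`
  -- while `s ∉ Q`.
  have hPQ : P ≤ Q := by
    intro c hc
    obtain ⟨s, hs, r, h⟩ := (hA.mem_iff _).1 (hw c hc) y hy
    rw [← mul_assoc, ← map_mul] at h
    exact (hQ.isPrime.mem_or_mem (hQw _ _ h)).resolve_left fun h => hs (hQy h)
  obtain rfl := hQ.eq_of_le hP0 hPQ
  exact ⟨hQ, ⟨y, hy, hQy⟩, hQw⟩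

variable (hdim : ∀ P Q : Ideal S, P.IsPrime → P ≠ ⊥ → Q.IsPrime → P < Q → Q.IsMaximal)

include hdim

/-- The torsion vanishes unless `P` is divisorial and below `𝒰`. In that case `w ↦ πw` exhibits it
as a subquotient of `A/(P S_P ∩ A)`: if `πw ∈ P S_P = πS_P`, then `w ∈ S_P`, and this forces `w ∈
A`. -/
theorem isNoetherian_idealTorsion_of_isPrime {P : Ideal S} [hP : P.IsPrime] (hP0 : P ≠ ⊥) :
    IsNoetherian A (idealTorsion A (F ⧸ LinearMap.range (Algebra.linearMap A F)) P) := by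
  set B := LinearMap.range (Algebra.linearMap A F)
  set T := idealTorsion A (F ⧸ B) P
  have hT : ∀ w : F, B.mkQ w ∈ T ↔ ∀ c ∈ P, ∃ a, algebraMap A F a = algebraMap S F c * w := by
    intro w
    have : ∀ c, algebraMap S A c • B.mkQ w = 0 ↔
        ∃ a, algebraMap A F a = algebraMap S F c * w := fun c => by
      rw [← map_smul, Submodule.mkQ_apply, Submodule.Quotient.mk_eq_zero, Algebra.smul_def,
        ← IsScalarTower.algebraMap_apply]
      rfl
    exact ⟨fun h c hc => (this c).1 (h c hc), fun h c hc => (this c).2 (h c hc)⟩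
  by_cases hdiv : IsDivisorial P ∧ ∃ y ∈ 𝒰, P ≤ y
  · obtain ⟨hdiv, y, hy, hPy⟩ := hdiv
    have hinj := injective (S := S) (A := A) (F := F)
    have hfr := hA.isFractionalAt hy hPy
    obtain ⟨π, hπ, v, hv, hgen⟩ := hdiv.exists_generator
    have hone := isOneDimOverring_quotient_localContraction hinj hfr
      fun Q hQ hlt => hdim P Q hP hP0 hQ hlt
    have := isPrime_localContraction hinj hfr
    have hnoeth := hone.isNoetherianRing
    let p := localContraction P hfr
    have hnoeth : IsNoetherian A (A ⧸ p) :=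
      (LinearMap.isNoetherian_iff_of_bijective
        (⟨⟨id, fun _ _ => rfl⟩, fun _ _ => rfl⟩ : (A ⧸ p) →ₛₗ[Ideal.Quotient.mk p] (A ⧸ p))
        Function.bijective_id).2 hnoeth
    have hex : ∀ w : T.comap B.mkQ, ∃ a, algebraMap A F a = algebraMap S F π * w := fun w =>
      (hT w).1 w.2 π hπ
    choose f hf using hex
    have hAinj := FaithfulSMul.algebraMap_injective A F
    let φ : T.comap B.mkQ →ₗ[A] A :=
      { toFun := f
        map_add' := fun x y => hAinj (by
          rw [map_add, hf, hf, hf, Submodule.coe_add, mul_add])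
        map_smul' := fun a x => hAinj (by
          rw [hf, RingHom.id_apply, smul_eq_mul, map_mul, hf, Submodule.coe_smul,
            Algebra.smul_def, mul_left_comm]) }
    have hmaps : ∀ x ∈ T.comap B.mkQ, B.mkQ x ∈ T := fun x hx => hx
    refine isNoetherian_of_ker_le (p.mkQ ∘ₗ φ) (B.mkQ.restrict hmaps) ?_ ?_
    · rintro ⟨y, hy⟩
      obtain ⟨w, rfl⟩ := B.mkQ_surjective y
      exact ⟨⟨w, hy⟩, rfl⟩
    · rintro ⟨w, hwT⟩ hker
      have hmem : φ ⟨w, hwT⟩ ∈ p := by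
        rw [LinearMap.mem_ker, LinearMap.comp_apply, Submodule.mkQ_apply,
          Submodule.Quotient.mk_eq_zero] at hker
        exact hker
      obtain ⟨s, hs, r, hr, h⟩ := hmem
      obtain ⟨d, hd⟩ := hgen r hr
      have hwr : algebraMap S F (v * s) * w = algebraMap S F d := by
        have hπ0 : algebraMap S F π ≠ 0 := fun h0 => by
          have : π = 0 := IsFractionRing.injective S F (by simpa using h0)
          refine hP0 (le_bot_iff.1 fun c hc => ?_)
          obtain ⟨d, hd⟩ := hgen c hc
          rw [this, mul_zero] at hd
          exact (mul_eq_zero.1 hd).resolve_left fun h => hv (h ▸ P.zero_mem)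
        have h2 := congrArg (algebraMap A F) h
        rw [map_mul, ← IsScalarTower.algebraMap_apply, ← IsScalarTower.algebraMap_apply] at h2
        have h3 : algebraMap A F (φ ⟨w, hwT⟩) = algebraMap S F π * w := hf _
        rw [h3] at h2
        have h4 := congrArg (algebraMap S F) hd
        rw [map_mul, map_mul, ← h2] at h4
        apply mul_right_cancel₀ hπ0
        rw [← h4, map_mul]
        ring
      have : ∃ a, algebraMap A F a = w := by
        by_contra! hcon
        have := (hA.isDivisorial_of_mul_mem hP0 ((hT w).1 hwT) hcon).2.2 _ _ hwr
        exact hP.mul_notMem hv hs this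
      obtain ⟨a, rfl⟩ := this
      refine LinearMap.mem_ker.2 (Subtype.ext ?_)
      change B.mkQ _ = 0
      rw [Submodule.mkQ_apply, Submodule.Quotient.mk_eq_zero]
      exact ⟨a, rfl⟩
  · have : T = ⊥ := by
      refine le_bot_iff.1 fun x hx => ?_
      obtain ⟨w, rfl⟩ := B.mkQ_surjective x
      by_contra hne
      obtain ⟨h1, h2, -⟩ := hA.isDivisorial_of_mul_mem hP0 ((hT w).1 hx) fun a ha => hne (by
        rw [Submodule.mem_bot, Submodule.mkQ_apply, Submodule.Quotient.mk_eq_zero]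
        exact ⟨a, ha⟩)
      exact hdiv ⟨h1, h2⟩
    rw [this]
    infer_instance

/-- Noetherian induction: a proper non-prime `I` contains a product of two strictly larger ideals `I
+ (x)` and `I + (y)`. -/
theorem isNoetherian_idealTorsion (I : Ideal S) (hI : I ≠ ⊥) :
    IsNoetherian A (idealTorsion A (F ⧸ LinearMap.range (Algebra.linearMap A F)) I) := by
  induction I using IsNoetherian.induction with | hgt I ih =>
  change Ideal S at I
  by_cases hp : I.IsPrime
  · exact hA.isNoetherian_idealTorsion_of_isPrime hdim hI
  by_cases htop : I = ⊤
  · have : idealTorsion A (F ⧸ LinearMap.range (Algebra.linearMap A F)) I = ⊥ := by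
      refine le_bot_iff.1 fun x hx => ?_
      simpa using hx 1 (htop ▸ Submodule.mem_top)
    rw [this]
    infer_instance
  obtain ⟨x, hx, y, hy, hxy⟩ := (Ideal.not_isPrime_iff.1 hp).resolve_left htop
  have hlt : ∀ z ∉ I, I < I ⊔ Ideal.span {z} := fun z hz => by
    refine lt_of_le_of_ne le_sup_left fun h => hz ?_
    rw [h]
    exact Ideal.mem_sup_right (Ideal.mem_span_singleton_self z)
  have h1 := ih _ (hlt x hx) (ne_bot_of_le_ne_bot hI le_sup_left)
  have h2 := ih _ (hlt y hy) (ne_bot_of_le_ne_bot hI le_sup_left)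
  have h3 := isNoetherian_idealTorsion_mul (A := A)
    (H := F ⧸ LinearMap.range (Algebra.linearMap A F)) (I ⊔ Ideal.span {x}) (I ⊔ Ideal.span {y})
  refine isNoetherian_of_le (idealTorsion_anti ?_) (t := idealTorsion A _
    ((I ⊔ Ideal.span {x}) * (I ⊔ Ideal.span {y})))
  rw [Ideal.sup_mul, Ideal.mul_sup, Ideal.mul_sup, Ideal.span_singleton_mul_span_singleton]
  exact sup_le (sup_le Ideal.mul_le_left Ideal.mul_le_left)
    (sup_le Ideal.mul_le_right (by simpa [Ideal.span_le] using hxy))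

include F in
omit [IsNoetherianRing S] [IsIntegrallyClosed S] hA hdim in
theorem comap_ne_bot {I : Ideal A} (hI : I ≠ ⊥) : I.comap (algebraMap S A) ≠ ⊥ := by
  obtain ⟨c, hc, hc0⟩ := Submodule.exists_mem_ne_zero_of_ne_bot hI
  obtain ⟨⟨r, s⟩, h⟩ := IsLocalization.surj (nonZeroDivisors S) (algebraMap A F c)
  have hAinj := FaithfulSMul.algebraMap_injective A F
  have h' : c * algebraMap S A s = algebraMap S A r := hAinj (by
    rw [map_mul, ← IsScalarTower.algebraMap_apply, ← IsScalarTower.algebraMap_apply, h])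
  intro hbot
  have hr : r ∈ I.comap (algebraMap S A) := by
    rw [Ideal.mem_comap, ← h']
    exact I.mul_mem_right _ hc
  rw [hbot, Ideal.mem_bot] at hr
  have h0 : algebraMap A F c * algebraMap S F s = 0 := by simpa [hr] using h
  rcases mul_eq_zero.1 h0 with h0 | h0
  · exact hc0 (hAinj (by simpa using h0))
  · exact nonZeroDivisors.ne_zero s.2 (IsFractionRing.injective S F (h0.trans (map_zero _).symm))

/-- For `a ∈ I` coming from `S`, division by `a` embeds `A/aA` in the `a`-torsion of `F/A`. -/
theorem isNoetherianRing : IsNoetherianRing A := by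
  have hAinj := FaithfulSMul.algebraMap_injective A F
  rw [isNoetherianRing_iff_ideal_fg]
  intro I
  by_cases hI : I = ⊥
  · exact hI ▸ Submodule.fg_bot
  obtain ⟨a, haI, ha0⟩ := Submodule.exists_mem_ne_zero_of_ne_bot (comap_ne_bot (S := S) (F := F) hI)
  set B := LinearMap.range (Algebra.linearMap A F)
  have haF : algebraMap S F a ≠ 0 := fun h => ha0 (IsFractionRing.injective S F (by simpa using h))
  have h1 := hA.isNoetherian_idealTorsion hdim (Ideal.span {a}) (by simpa using ha0)
  let φ : A →ₗ[A] idealTorsion A (F ⧸ B) (Ideal.span {a}) :=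
    { toFun := fun x => ⟨B.mkQ ((algebraMap S F a)⁻¹ * algebraMap A F x), fun c hc => by
        obtain ⟨d, rfl⟩ := Ideal.mem_span_singleton'.1 hc
        rw [← map_smul, Submodule.mkQ_apply, Submodule.Quotient.mk_eq_zero]
        refine ⟨algebraMap S A d * x, ?_⟩
        rw [Algebra.linearMap_apply, Algebra.smul_def, map_mul, map_mul, map_mul,
          ← IsScalarTower.algebraMap_apply, ← IsScalarTower.algebraMap_apply]
        field_simp⟩
      map_add' := fun x y => Subtype.ext (by simp [mul_add])
      map_smul' := fun c x => Subtype.ext (by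
        have : (algebraMap S F a)⁻¹ * algebraMap A F (c * x) =
            c • ((algebraMap S F a)⁻¹ * algebraMap A F x) := by
          rw [map_mul, mul_left_comm, Algebra.smul_def]
        exact (congrArg B.mkQ this).trans (map_smul _ _ _)) }
  have : IsNoetherian A (A ⧸ Ideal.span {algebraMap S A a}) := by
    refine isNoetherian_of_ker_le φ (Submodule.mkQ _) (Submodule.mkQ_surjective _) ?_
    intro x hx
    have h2 : B.mkQ ((algebraMap S F a)⁻¹ * algebraMap A F x) = 0 :=
      congrArg Subtype.val (LinearMap.mem_ker.1 hx)
    rw [Submodule.mkQ_apply, Submodule.Quotient.mk_eq_zero] at h2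
    obtain ⟨b, hb⟩ := h2
    rw [LinearMap.mem_ker, Submodule.mkQ_apply, Submodule.Quotient.mk_eq_zero]
    refine Ideal.mem_span_singleton'.2 ⟨b, hAinj ?_⟩
    rw [Algebra.linearMap_apply] at hb
    rw [map_mul, ← IsScalarTower.algebraMap_apply, hb]
    field_simp
  exact fg_of_isNoetherian_quotient_span (c := algebraMap S A a) haI

/-- Every nonzero prime of `A` contains `P S_P ∩ A` for some divisorial `P` below `𝒰`. -/
theorem exists_localContraction_le (p : Ideal A) [hp : p.IsPrime] (hp0 : p ≠ ⊥) :
    ∃ y ∈ 𝒰, ∃ P : Ideal S, IsDivisorial P ∧ P ≤ y ∧ ∃ (_ : P.IsPrime) (h : IsFractionalAt A P),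
      localContraction P h ≤ p := by
  have hnoeth := hA.isNoetherianRing hdim
  have hAinj := FaithfulSMul.algebraMap_injective A F
  have hinj := injective (S := S) (A := A) (F := F)
  obtain ⟨a, hap, ha0⟩ := Submodule.exists_mem_ne_zero_of_ne_bot
    (comap_ne_bot (S := S) (F := F) hp0)
  have haF : algebraMap S F a ≠ 0 := fun h => ha0 (IsFractionRing.injective S F (by simpa using h))
  -- The ideal `aA` is written as a colon ideal so that a prime `q` minimal over it is again a colon
  -- ideal `(aA : x)`; equivalently `q` is the denominator ideal of `z = x/a`.
  have hle : (Ideal.span {algebraMap S A a}).colon {1} ≤ p := by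
    intro c hc
    rw [Submodule.mem_colon_singleton, smul_eq_mul, mul_one] at hc
    exact (Ideal.span_singleton_le_iff_mem p).2 hap hc
  obtain ⟨q, hqmin, hqp⟩ := Ideal.exists_minimalPrimes_le hle
  have hq : q.IsPrime := hqmin.1.1
  have haq : algebraMap S A a ∈ q := hqmin.1.2 (by
    rw [Submodule.mem_colon_singleton, smul_eq_mul, mul_one]
    exact Ideal.mem_span_singleton_self _)
  obtain ⟨x, hx⟩ := Submodule.exists_eq_colon_of_mem_minimalPrimes hqmin
  let z : F := (algebraMap S F a)⁻¹ * algebraMap A F x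
  have hqz : ∀ c, c ∈ q ↔ ∃ b, algebraMap A F b = algebraMap A F c * z := by
    intro c
    rw [hx, Submodule.mem_colon_singleton, smul_eq_mul, Ideal.mem_span_singleton']
    refine exists_congr fun b => ?_
    rw [← hAinj.eq_iff, map_mul, map_mul, ← IsScalarTower.algebraMap_apply]
    simp only [z]
    field_simp
  have hz : ∃ y ∈ 𝒰, ∀ s ∉ y, ∀ r, algebraMap S F s * z ≠ algebraMap S F r := by
    by_contra! hcon
    obtain ⟨b, hb⟩ := (hA.mem_iff z).2 hcon
    exact hq.one_notMem ((hqz 1).2 ⟨b, by simpa using hb⟩)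
  obtain ⟨y, hy, hyz⟩ := hz
  have := hA.isPrime y hy
  obtain ⟨P, hP, hPy, hPz⟩ := exists_isDivisorial hyz
  have hPp := hP.isPrime
  have hfr := hA.isFractionalAt hy hPy
  -- If `cz ∈ A`, any numerator of `c` is, up to a factor outside `y`, a denominator of `z`, hence
  -- in `P`. So `q ∩ S` is a nonzero prime inside the divisorial `P`, and equals it.
  have hq1 : q ≤ localContraction P hfr := by
    intro c hc
    obtain ⟨s, hs, r, hr⟩ := hfr c
    refine ⟨s, hs, r, ?_, hr⟩
    obtain ⟨b, hb⟩ := (hqz c).1 hc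
    obtain ⟨s', hs', r', h'⟩ := (hA.mem_iff _).1 ⟨b, rfl⟩ y hy
    have h2 := congrArg (algebraMap A F) hr
    rw [map_mul, ← IsScalarTower.algebraMap_apply, ← IsScalarTower.algebraMap_apply] at h2
    have := hPz (s' * r) (s * r') (by
      rw [map_mul, map_mul, ← h2, ← h', hb]
      ring)
    exact (hPp.mem_or_mem this).resolve_left fun h => hs' (hPy h)
  have hqP : q.comap (algebraMap S A) = P := by
    refine hP.eq_of_le (comap_ne_bot (F := F) fun h => ?_) ?_
    · rw [h, Ideal.mem_bot] at haq
      exact ha0 (hinj (by simpa using haq))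
    · conv_rhs => rw [← comap_localContraction hinj hfr]
      exact Ideal.comap_mono hq1
  refine ⟨y, hy, P, hP, hPy, hPp, hfr, le_trans ?_ hqp⟩
  rintro c ⟨s, hs, r, hr, h⟩
  rw [← hqP, Ideal.mem_comap] at hs hr
  exact (hq.mem_or_mem (h ▸ hr)).resolve_left hs

end IsIntersectionOfLocalizations
end Overring

/-! ### Finite modules over complete rings -/

section CompleteModules

variable {R : Type*} [CommRing R] (I : Ideal R)

/-- For finite `M` the completion is spanned over the completed ring by the image of `M`, and `R`
already surjects onto its completion. -/
theorem isPrecomplete_of_finite [IsPrecomplete I R] (M : Type*) [AddCommGroup M] [Module R M]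
    [Module.Finite R M] : IsPrecomplete I M := by
  rw [← AdicCompletion.of_surjective_iff]
  intro y
  obtain ⟨z, rfl⟩ := AdicCompletion.ofTensorProduct_surjective_of_finite I M y
  induction z using TensorProduct.induction_on with
  | zero => exact ⟨0, by simp⟩
  | tmul r x =>
    obtain ⟨r, rfl⟩ := AdicCompletion.of_surjective I R r
    refine ⟨r • x, ?_⟩
    rw [AdicCompletion.ofTensorProduct_tmul, map_smul]
    exact (algebraMap_smul (AdicCompletion I R) r (AdicCompletion.of I M x)).symm
  | add a b ha hb =>
    obtain ⟨a', ha⟩ := ha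
    obtain ⟨b', hb⟩ := hb
    exact ⟨a' + b', by rw [map_add, map_add, ha, hb]⟩

/-- Complete Nakayama: lifts of generators of `M/IM` generate by successive approximation, which
converges in `R^n` and has a unique limit in the separated `M`. -/
theorem finite_of_finite_quotient_smul_top [IsPrecomplete I R] (M : Type*) [AddCommGroup M]
    [Module R M] [IsHausdorff I M] [Module.Finite R (M ⧸ (I • ⊤ : Submodule R M))] :
    Module.Finite R M := by
  obtain ⟨n, g, hg⟩ := Module.Finite.exists_fin' R (M ⧸ (I • ⊤ : Submodule R M))
  obtain ⟨f, hf⟩ := Module.projective_lifting_property (Submodule.mkQ (I • ⊤ : Submodule R M)) g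
    (Submodule.mkQ_surjective _)
  have := isPrecomplete_of_finite I (Fin n → R)
  exact Module.Finite.of_surjective f
    (surjective_of_mkQ_comp_surjective (I := I) (by rwa [hf]))

end CompleteModules

/-! ### Moving a chain of primes to contain a given element -/

section Height

/-- In a noetherian ring, a chain of four primes ending in `M ∋ t` yields a chain of three primes
containing `t` and ending in `M`. -/
theorem exists_prime_chain_of_mem {S : Type*} [CommRing S] [IsNoetherianRing S]
    {Q₀ Q₁ Q₂ M : Ideal S} [Q₀.IsPrime] [Q₁.IsPrime] [Q₂.IsPrime] [hM : M.IsPrime]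
    (h₀ : Q₀ < Q₁) (h₁ : Q₁ < Q₂) (h₂ : Q₂ < M) {t : S} (ht : t ∈ M) :
    ∃ P₀ P₁ : Ideal S, P₀.IsPrime ∧ P₁.IsPrime ∧ t ∈ P₀ ∧ P₀ < P₁ ∧ P₁ < M := by
  by_contra! hcon
  let φ := Ideal.Quotient.mk (Ideal.span {t})
  have hφ : Function.Surjective φ := Ideal.Quotient.mk_surjective
  have hle : Ideal.span {t} ≤ M := by simpa [Ideal.span_le] using ht
  have hp : (M.map φ).IsPrime := Ideal.isPrime_map_quotientMk_of_isPrime hle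
  have hcm : (M.map φ).comap φ = M := by
    rw [Ideal.comap_map_of_surjective' _ hφ, Ideal.mk_ker, sup_eq_left]
    exact hle
  have htm : ∀ q : Ideal (S ⧸ Ideal.span {t}), t ∈ q.comap φ := fun q => by
    rw [Ideal.mem_comap, Ideal.Quotient.eq_zero_iff_mem.2 (Ideal.mem_span_singleton_self t)]
    exact q.zero_mem
  have hlt : ∀ p q : Ideal (S ⧸ Ideal.span {t}), p < q → p.comap φ < q.comap φ := fun p q h =>
    (Ideal.orderEmbeddingOfSurjective φ hφ).lt_iff_lt.2 h
  -- Without such a chain `M/(t)` has height at most one, so `M` has height at most two, against the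
  -- given chain of length three.
  have h1 : (M.map φ).height ≤ (1 : ℕ) := by
    rw [Ideal.height_le_iff]
    intro q hq hqM
    suffices q.height = 0 by rw [this]; norm_num
    rw [Ideal.height_eq_zero_iff]
    refine ⟨⟨hq, bot_le⟩, fun r hr hrq => ?_⟩
    by_contra hqr
    have h2 := hlt _ _ (lt_of_le_not_ge hrq hqr)
    have h3 := hlt _ _ hqM
    rw [hcm] at h3
    have := hr.1
    exact hcon _ _ inferInstance inferInstance (htm r) h2 h3
  have h2 := Ideal.height_le_height_add_one_of_mem ht
  have h3 : M.height ≤ 2 := h2.trans (by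
    have : (2 : ℕ∞) = (1 : ℕ) + 1 := by norm_num
    rw [this]
    gcongr)
  have e0 := Ideal.height_add_one_le_of_lt_of_isPrime h₀
  have e1 := Ideal.height_add_one_le_of_lt_of_isPrime h₁
  have e2 := Ideal.height_add_one_le_of_lt_of_isPrime h₂
  have e3 : Q₀.height + 1 + 1 + 1 ≤ 2 :=
    le_trans (by gcongr; exact le_trans (by gcongr) e1) (e2.trans h3)
  have e4 : (3 : ℕ∞) ≤ Q₀.height + 1 + 1 + 1 := by
    rw [add_assoc, add_assoc]
    exact le_add_self
  exact absurd (e4.trans e3) (by decide)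

end Height

/-! ### Artinian algebras of finite type over the residue field -/

section FiniteOverBase

variable {R S A : Type*} [CommRing R] [IsLocalRing R] [CommRing S] [CommRing A] [Algebra R S]
  [Algebra S A] [Algebra R A] [IsScalarTower R S A]

theorem finite_of_isArtinianRing_of_le_comap [Algebra.FiniteType R S] [IsArtinianRing S]
    (h : IsLocalRing.maximalIdeal R ≤ RingHom.ker (algebraMap R S)) : Module.Finite R S := by
  let k := R ⧸ IsLocalRing.maximalIdeal R
  let : Field k := Ideal.Quotient.field _
  let : Algebra k S := (Ideal.Quotient.lift _ (algebraMap R S) h).toAlgebra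
  have : IsScalarTower R k S := IsScalarTower.of_algebraMap_eq fun r => rfl
  have : Algebra.FiniteType k S := Algebra.FiniteType.of_restrictScalars_finiteType R k S
  have : Module.Finite k S := (Module.finite_iff_isArtinianRing k S).2 inferInstance
  exact Module.Finite.trans k S

theorem finite_quotient_of_isArtinianRing [Algebra.FiniteType R S] {K : Ideal A}
    [Module.Finite S (A ⧸ K)] [IsArtinianRing (S ⧸ K.comap (algebraMap S A))]
    (h : IsLocalRing.maximalIdeal R ≤ K.comap (algebraMap R A)) : Module.Finite R (A ⧸ K) := by
  let J := K.comap (algebraMap S A)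
  have h1 : Module.Finite R (S ⧸ J) := by
    refine finite_of_isArtinianRing_of_le_comap fun r hr => ?_
    rw [RingHom.mem_ker, IsScalarTower.algebraMap_apply R S, Ideal.Quotient.algebraMap_eq,
      Ideal.Quotient.eq_zero_iff_mem, Ideal.mem_comap, ← IsScalarTower.algebraMap_apply]
    exact h hr
  let : Algebra (S ⧸ J) (A ⧸ K) := Ideal.quotientAlgebra
  have : IsScalarTower S (S ⧸ J) (A ⧸ K) := IsScalarTower.of_algebraMap_eq fun r => rfl
  have : IsScalarTower R (S ⧸ J) (A ⧸ K) := IsScalarTower.of_algebraMap_eq fun r => by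
    rw [IsScalarTower.algebraMap_apply R S (S ⧸ J), ← IsScalarTower.algebraMap_apply S,
      ← IsScalarTower.algebraMap_apply]
  have : Module.Finite (S ⧸ J) (A ⧸ K) := Module.Finite.of_restrictScalars_finite S _ _
  exact Module.Finite.trans (S ⧸ J) _

end FiniteOverBase

/-! ### From the affine coordinate ring to the ring of regular functions -/

section CurveRing

/-- The conditions on the coordinate ring `S` of an affine open of a relative normal curve. -/
structure IsCurveRing (R S : Type*) [CommRing R] [IsLocalRing R] [CommRing S] [Algebra R S] :
    Prop where
  injective : Function.Injective (algebraMap R S)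
  not_chain : ∀ (𝔯 : Ideal R) (P₀ P₁ P₂ : Ideal S), P₀.IsPrime → P₁.IsPrime → P₂.IsPrime →
    P₀.comap (algebraMap R S) = 𝔯 → P₁.comap (algebraMap R S) = 𝔯 →
    P₂.comap (algebraMap R S) = 𝔯 → P₀ < P₁ → P₁ < P₂ → False

variable {R S : Type*} [CommRing R] [IsLocalRing R] [CommRing S] [IsDomain S]
  [IsNoetherianRing S] [Algebra R S]

open IsLocalRing (maximalIdeal)

/-- With `⊥` and `P` in the generic fibre, a prime above `P` cannot be there too, so it lies over
the closed point. A further prime above `Q` would give a chain of length three, which can be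
replaced by three primes all containing `t`, too many for the closed fibre. -/
theorem IsCurveRing.isMaximal (hS : IsCurveRing R S) (hR0 : maximalIdeal R ≠ ⊥)
    (hR : ∀ p : Ideal R, p.IsPrime → p ≠ ⊥ → p = maximalIdeal R)
    (P Q : Ideal S) (hP : P.IsPrime) (hP0 : P ≠ ⊥) (hQ : Q.IsPrime) (hPQ : P < Q) :
    Q.IsMaximal ∧ Q.comap (algebraMap R S) = maximalIdeal R := by
  have hover : ∀ Q' : Ideal S, Q'.IsPrime → P < Q' →
      Q'.comap (algebraMap R S) = maximalIdeal R := by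
    intro Q' hQ' hlt
    by_contra hne
    have h0 : Q'.comap (algebraMap R S) = ⊥ := by
      by_contra h
      exact hne (hR _ inferInstance h)
    exact hS.not_chain ⊥ ⊥ P Q' inferInstance hP hQ'
      (by rw [← RingHom.ker_eq_comap_bot, RingHom.ker_eq_bot_iff_eq_zero]
          intro x hx
          exact hS.injective (by simpa using hx))
      (le_bot_iff.1 (h0 ▸ Ideal.comap_mono hlt.le)) h0 (bot_lt_iff_ne_bot.2 hP0) hlt
  refine ⟨?_, hover Q hQ hPQ⟩
  obtain ⟨M, hM, hQM⟩ := Ideal.exists_le_maximal Q hQ.ne_top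
  rcases hQM.eq_or_lt with rfl | hlt
  · exact hM
  exfalso
  have hMR := hover M hM.isPrime (hPQ.trans hlt)
  obtain ⟨t, ht, ht0⟩ := Submodule.exists_mem_ne_zero_of_ne_bot hR0
  have htM : algebraMap R S t ∈ M := by
    rw [← Ideal.mem_comap, hMR]
    exact ht
  obtain ⟨P₀, P₁, hP₀, hP₁, htP, h01, h1M⟩ :=
    exists_prime_chain_of_mem (bot_lt_iff_ne_bot.2 hP0) hPQ hlt htM
  have hc : ∀ P' : Ideal S, P'.IsPrime → P₀ ≤ P' →
      P'.comap (algebraMap R S) = maximalIdeal R := fun P' hP' hle =>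
    hR _ inferInstance fun h => ht0 (by
      have : t ∈ P'.comap (algebraMap R S) := hle htP
      rwa [h, Ideal.mem_bot] at this)
  exact hS.not_chain _ P₀ P₁ M hP₀ hP₁ hM.isPrime (hc _ hP₀ le_rfl) (hc _ hP₁ h01.le)
    (hc _ hM.isPrime (h01.trans h1M).le) h01 h1M

variable {A F : Type*} [IsIntegrallyClosed S] [CommRing A] [Field F] [Algebra S F]
  [IsFractionRing S F] [Algebra A F] [FaithfulSMul A F] [Algebra S A] [IsScalarTower S A F]
  {𝒰 : Set (Ideal S)} [Algebra R A] [IsScalarTower R S A]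

/-- What the completion argument uses about the ring `A` of functions regular on `U`. -/
structure IsRegularRing (R A : Type*) [CommRing R] [IsLocalRing R] [CommRing A] [Algebra R A] :
    Prop where
  injective : Function.Injective (algebraMap R A)
  isNoetherianRing : IsNoetherianRing A
  of_lt : ∀ P Q : Ideal A, P.IsPrime → P ≠ ⊥ → Q.IsPrime → P < Q →
    Q.IsMaximal ∧ maximalIdeal R ≤ Q.comap (algebraMap R A) ∧ Module.Finite R (A ⧸ Q)
  finite : ∀ P : Ideal A, P.IsPrime → P ≠ ⊥ → ¬ maximalIdeal R ≤ P.comap (algebraMap R A) →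
    Module.Finite R (A ⧸ P)

theorem IsIntersectionOfLocalizations.isRegularRing [IsNoetherianRing R]
    [IsAdicComplete (maximalIdeal R) R]
    [Algebra.FiniteType R S] (hA : IsIntersectionOfLocalizations S A F 𝒰)
    (hS : IsCurveRing R S) (hR0 : maximalIdeal R ≠ ⊥)
    (hR : ∀ p : Ideal R, p.IsPrime → p ≠ ⊥ → p = maximalIdeal R)
    (h𝒰 : ∀ y ∈ 𝒰, maximalIdeal R ≤ y.comap (algebraMap R S)) : IsRegularRing R A := by
  have hmax := hS.isMaximal hR0 hR
  have hdim : ∀ P Q : Ideal S, P.IsPrime → P ≠ ⊥ → Q.IsPrime → P < Q → Q.IsMaximal :=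
    fun P Q hP hP0 hQ h => (hmax P Q hP hP0 hQ h).1
  have hinj := IsIntersectionOfLocalizations.injective (S := S) (A := A) (F := F)
  have hnoeth := hA.isNoetherianRing hdim
  -- An ideal `K` strictly above `P S_P ∩ A` meets `S` strictly above `P`, so only maximal ideals
  -- over the closed point contain `K ∩ S`. By Krull–Akizuki `A/K` is finite over the artinian ring
  -- `S/(K ∩ S)`, which is finite over `R` when `K` contains `m`.
  have key : ∀ (y) (hy : y ∈ 𝒰) (P : Ideal S) [P.IsPrime] (hP : IsDivisorial P) (hPy : P ≤ y)
      (h : IsFractionalAt A P) (K : Ideal A), localContraction P h < K →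
      (∀ Q : Ideal S, Q.IsPrime → K.comap (algebraMap S A) ≤ Q →
        Q.IsMaximal ∧ Q.comap (algebraMap R S) = maximalIdeal R) ∧
      (maximalIdeal R ≤ K.comap (algebraMap R A) → Module.Finite R (A ⧸ K)) := by
    intro y hy P _ hP hPy h K hlt
    let p := localContraction P h
    have := isPrime_localContraction hinj h
    have hone := isOneDimOverring_quotient_localContraction hinj h
      fun Q hQ hlt => hdim P Q hP.isPrime hP.ne_bot hQ hlt
    have hK : K.map (Ideal.Quotient.mkₐ S p) ≠ ⊥ := by
      intro h0
      refine hlt.not_ge fun x hx => ?_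
      have : Ideal.Quotient.mk p x ∈ K.map (Ideal.Quotient.mkₐ S p) := Ideal.mem_map_of_mem _ hx
      rw [h0, Ideal.mem_bot] at this
      exact Ideal.Quotient.eq_zero_iff_mem.1 this
    obtain ⟨a, ha0, haK, hfin⟩ := hone.finite_quotient hK
    have haK' : a ∈ K.comap (algebraMap S A) := by
      have h1 : Ideal.Quotient.mk p (algebraMap S A a) ∈ K.map (Ideal.Quotient.mk p) := haK
      have h2 := Ideal.mem_comap.2 h1
      rwa [Ideal.comap_map_of_surjective' _ Ideal.Quotient.mk_surjective, Ideal.mk_ker,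
        sup_eq_left.2 hlt.le] at h2
    have haP : a ∉ P := by
      intro h1
      apply ha0
      rw [IsScalarTower.algebraMap_apply S A, Ideal.Quotient.algebraMap_eq,
        Ideal.Quotient.eq_zero_iff_mem, ← Ideal.mem_comap, comap_localContraction hinj h]
      exact h1
    have hPK : P ≤ K.comap (algebraMap S A) := by
      conv_lhs => rw [← comap_localContraction hinj h]
      exact Ideal.comap_mono hlt.le
    have hm : ∀ Q : Ideal S, Q.IsPrime → K.comap (algebraMap S A) ≤ Q →
        Q.IsMaximal ∧ Q.comap (algebraMap R S) = maximalIdeal R := by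
      intro Q hQ hle
      exact hmax P Q hP.isPrime hP.ne_bot hQ
        (lt_of_le_of_ne (hPK.trans hle) fun h => haP (h ▸ hle haK'))
    refine ⟨hm, fun hle => ?_⟩
    have hfin' : Module.Finite S (A ⧸ K) :=
      Module.Finite.equiv (DoubleQuot.quotQuotEquivQuotOfLEₐ S hlt.le).toLinearEquiv
    have : IsArtinianRing (S ⧸ K.comap (algebraMap S A)) := by
      rw [isArtinianRing_iff_krullDimLE_zero]
      refine Ring.KrullDimLE.mk₀ fun J hJ => ?_
      have h1 := (hm (J.comap (Ideal.Quotient.mk (K.comap (algebraMap S A)))) inferInstance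
        fun x hx => by
        rw [Ideal.mem_comap, (Ideal.Quotient.eq_zero_iff_mem (I := K.comap (algebraMap S A))).2 hx]
        exact J.zero_mem).1
      have := Ideal.map_eq_top_or_isMaximal_of_surjective
        (Ideal.Quotient.mk (K.comap (algebraMap S A))) Ideal.Quotient.mk_surjective h1
      rw [Ideal.map_comap_of_surjective _ Ideal.Quotient.mk_surjective] at this
      exact this.resolve_left hJ.ne_top
    exact finite_quotient_of_isArtinianRing (S := S) hle
  have key2 : ∀ (y) (hy : y ∈ 𝒰) (P : Ideal S) [P.IsPrime] (hP : IsDivisorial P) (hPy : P ≤ y)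
      (h : IsFractionalAt A P) (Q : Ideal A), Q.IsPrime → localContraction P h < Q →
      maximalIdeal R ≤ Q.comap (algebraMap R A) := by
    intro y hy P _ hP hPy h Q hQ hlt
    rw [← ((key y hy P hP hPy h Q hlt).1 _ inferInstance le_rfl).2, Ideal.comap_comap,
      ← IsScalarTower.algebraMap_eq]
  refine ⟨?_, hnoeth, fun P₀ Q hP₀ hP0 hQ hlt => ?_, fun P₀ hP₀ hP0 hnot => ?_⟩
  · rw [IsScalarTower.algebraMap_eq R S A]
    exact hinj.comp hS.injective
  · obtain ⟨y, hy, P, hP, hPy, hPp, h, hle⟩ := hA.exists_localContraction_le hdim P₀ hP0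
    have hlt' := hle.trans_lt hlt
    have hm := key2 y hy P hP hPy h Q hQ hlt'
    have := isPrime_localContraction hinj h
    refine ⟨?_, hm, (key y hy P hP hPy h Q hlt').2 hm⟩
    have hone := isOneDimOverring_quotient_localContraction hinj h
      fun Q hQ hlt => hdim P Q hP.isPrime hP.ne_bot hQ hlt
    let p := localContraction P h
    have hQp : (Q.map (Ideal.Quotient.mk p)).IsPrime :=
      Ideal.isPrime_map_quotientMk_of_isPrime hlt'.le
    have hQ0 : Q.map (Ideal.Quotient.mk p) ≠ ⊥ := fun h0 => hlt'.not_ge fun x hx => by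
      have : Ideal.Quotient.mk p x ∈ Q.map (Ideal.Quotient.mk p) := Ideal.mem_map_of_mem _ hx
      rw [h0, Ideal.mem_bot] at this
      exact Ideal.Quotient.eq_zero_iff_mem.1 this
    have := hone.isMaximal_of_ne_bot hQ0
    have h2 := Ideal.comap_isMaximal_of_surjective (Ideal.Quotient.mk p)
      Ideal.Quotient.mk_surjective (K := Q.map (Ideal.Quotient.mk p))
    rwa [Ideal.comap_map_of_surjective' _ Ideal.Quotient.mk_surjective, Ideal.mk_ker,
      sup_eq_left.2 hlt'.le] at h2
  · obtain ⟨y, hy, P, hP, hPy, hPp, h, hle⟩ := hA.exists_localContraction_le hdim P₀ hP0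
    rcases hle.eq_or_lt with rfl | hlt
    swap
    · exact absurd (key2 y hy P hP hPy h P₀ hP₀ hlt) hnot
    have := hA.isPrime y hy
    have hfy := hA.isFractionalAt hy le_rfl
    let mA := (maximalIdeal R).map (algebraMap R A)
    -- `K` is proper because it lies in `y S_y ∩ A`; here the points of `𝒰` being in the closed
    -- fibre is essential. Properness makes the noetherian domain `C` separated by Krull's
    -- intersection theorem, and `C/mC = A/K` is finite over `R`.
    let K := localContraction P h ⊔ mA
    have hK : K ≤ localContraction y hfy := by
      refine sup_le (localContraction_mono hinj h hfy hPy) (Ideal.map_le_iff_le_comap.2 ?_)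
      rw [IsScalarTower.algebraMap_eq R S A, ← Ideal.comap_comap, comap_localContraction hinj hfy]
      exact h𝒰 y hy
    have hmK : maximalIdeal R ≤ K.comap (algebraMap R A) :=
      Ideal.map_le_iff_le_comap.1 le_sup_right
    have hlt : localContraction P h < K :=
      lt_of_le_of_ne le_sup_left fun h => hnot (h ▸ hmK)
    have hfin := (key y hy P hP hPy h K hlt).2 hmK
    let p := localContraction P h
    let C := A ⧸ p
    have hKt : K ≠ ⊤ := fun ht => (isPrime_localContraction hinj hfy).ne_top
      (top_le_iff.1 (ht ▸ hK))
    have hmC : (maximalIdeal R).map (algebraMap R C) = K.map (Ideal.Quotient.mk p) := by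
      rw [Ideal.map_sup, Ideal.map_quotient_self, bot_sup_eq, Ideal.map_map]
      rfl
    have hmCt : (maximalIdeal R).map (algebraMap R C) ≠ ⊤ := by
      rw [hmC]
      intro ht
      apply hKt
      have h2 := congrArg (Ideal.comap (Ideal.Quotient.mk p)) ht
      rwa [Ideal.comap_map_of_surjective' _ Ideal.Quotient.mk_surjective, Ideal.mk_ker,
        sup_eq_left.2 hlt.le, Ideal.comap_top] at h2
    have hH : IsHausdorff (maximalIdeal R) C :=
      IsHausdorff.map_algebraMap_iff.1 (IsHausdorff.of_isDomain _ hmCt)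
    have hfin2 : Module.Finite R (C ⧸ (maximalIdeal R • ⊤ : Submodule R C)) := by
      let g : (A ⧸ K) →ₗ[R] (C ⧸ (maximalIdeal R • ⊤ : Submodule R C)) :=
        (K.restrictScalars R).liftQ
          ((Submodule.mkQ (maximalIdeal R • ⊤ : Submodule R C)) ∘ₗ
            (Ideal.Quotient.mkₐ R p).toLinearMap) (by
          intro x hx
          rw [LinearMap.mem_ker, LinearMap.comp_apply, Submodule.mkQ_apply,
            Submodule.Quotient.mk_eq_zero, Ideal.smul_top_eq_map, hmC]
          exact Ideal.mem_map_of_mem _ hx)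
      refine Module.Finite.of_surjective g ?_
      intro c
      obtain ⟨c, rfl⟩ := Submodule.mkQ_surjective _ c
      obtain ⟨a, rfl⟩ := Ideal.Quotient.mk_surjective c
      exact ⟨Ideal.Quotient.mk K a, rfl⟩
    exact finite_of_finite_quotient_smul_top (maximalIdeal R) C

end CurveRing

/-! ### Ideals and primes of an adic completion -/

section Completion

variable {A : Type*} [CommRing A] [IsNoetherianRing A] (I : Ideal A)

/-- Density of `A` in its completion; since `I` is finitely generated, the kernel of evaluation at
level `n` is the extension of `I ^ n`. -/
theorem exists_sub_algebraMap_mem_map_pow (n : ℕ) (b : AdicCompletion I A) :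
    ∃ a : A, b - algebraMap A (AdicCompletion I A) a ∈
      (I ^ n).map (algebraMap A (AdicCompletion I A)) := by
  obtain ⟨a, ha⟩ := Submodule.Quotient.mk_surjective _ (AdicCompletion.eval I A n b)
  refine ⟨a, ?_⟩
  have h1 : b - algebraMap A (AdicCompletion I A) a ∈ (AdicCompletion.eval I A n).ker := by
    rw [LinearMap.mem_ker, map_sub, ← ha, sub_eq_zero]
    rfl
  rw [← AdicCompletion.pow_smul_top_eq_ker_eval I.fg_of_isNoetherianRing] at h1
  rw [Ideal.smul_top_eq_map] at h1
  exact h1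

/-- Completing `p → A → A/p` stays exact, the completion of `p` has image the extended ideal because
`p` is finitely generated, and `A/p` is its own completion. -/
theorem bijective_quotientMap_adicCompletion (p : Ideal A) [IsAdicComplete I (A ⧸ p)] :
    Function.Bijective (Ideal.quotientMap (p.map (algebraMap A (AdicCompletion I A)))
      (algebraMap A (AdicCompletion I A)) Ideal.le_comap_map) := by
  let Φ := AdicCompletion.map I (Submodule.mkQ p)
  have hΦ : ∀ a, Φ (algebraMap A _ a) = AdicCompletion.of I (A ⧸ p) (Submodule.mkQ p a) :=
    fun a => AdicCompletion.map_of I _ a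
  have hker : p.map (algebraMap A (AdicCompletion I A)) ≤ LinearMap.ker Φ := by
    refine Ideal.map_le_iff_le_comap.2 fun a ha => ?_
    have : Submodule.mkQ p a = 0 := (Submodule.Quotient.mk_eq_zero p).2 ha
    exact LinearMap.mem_ker.2 (by rw [hΦ, this, map_zero])
  constructor
  · rw [injective_iff_map_eq_zero]
    intro x hx
    obtain ⟨a, rfl⟩ := Ideal.Quotient.mk_surjective x
    rw [Ideal.quotientMap_mk, Ideal.Quotient.eq_zero_iff_mem] at hx
    have h1 := LinearMap.mem_ker.1 (hker hx)
    rw [hΦ] at h1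
    exact AdicCompletion.of_injective I (A ⧸ p) (h1.trans (map_zero _).symm)
  · intro y
    obtain ⟨b, rfl⟩ := Ideal.Quotient.mk_surjective y
    obtain ⟨x, hx⟩ := AdicCompletion.of_surjective I (A ⧸ p) (Φ b)
    obtain ⟨a, rfl⟩ := Submodule.mkQ_surjective p x
    refine ⟨Ideal.Quotient.mk p a, ?_⟩
    rw [Ideal.quotientMap_mk, eq_comm, Ideal.Quotient.mk_eq_mk_iff_sub_mem]
    have h1 : Φ (b - algebraMap A _ a) = 0 := by rw [map_sub, hΦ, hx, sub_self]
    have hex := AdicCompletion.map_exact (I := I) (f := Submodule.subtype p) (g := Submodule.mkQ p)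
      (Submodule.subtype_injective p) (LinearMap.exact_subtype_mkQ p) (Submodule.mkQ_surjective p)
    obtain ⟨z, hz⟩ := (hex _).1 h1
    rw [← hz]
    obtain ⟨w, rfl⟩ := AdicCompletion.ofTensorProduct_surjective_of_finite I p z
    clear hz
    induction w using TensorProduct.induction_on with
    | zero => simp
    | tmul r x =>
      rw [AdicCompletion.ofTensorProduct_tmul, map_smul, AdicCompletion.map_of]
      exact Ideal.mul_mem_left _ _ (Ideal.mem_map_of_mem _ x.2)
    | add c d hc hd =>
      rw [map_add, map_add]
      exact Ideal.add_mem _ hc hd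

theorem isAdicComplete_map_adicCompletion :
    IsAdicComplete (I.map (algebraMap A (AdicCompletion I A))) (AdicCompletion I A) :=
  (IsAdicComplete.map_algebraMap_iff _ _).2 (AdicCompletion.isAdicComplete I.fg_of_isNoetherianRing)

/-- By Cohen's theorem only primes `Q` matter. Modulo `τ`, the image of `t`, the completion is a
quotient of `A`, which settles `τ ∈ Q`. If `τ ∉ Q`, then `Q ∩ (τ) = τQ`, so `Q/JQ` is a subquotient
of a noetherian module and complete Nakayama applies. -/
theorem isNoetherianRing_adicCompletion {t : A} (htI : t ∈ I) {k : ℕ}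
    (hk : I ^ k ≤ Ideal.span {t}) : IsNoetherianRing (AdicCompletion I A) := by
  have := isAdicComplete_map_adicCompletion I
  let B' := AdicCompletion I A
  let τ : B' := algebraMap A B' t
  have hBt : IsNoetherianRing (B' ⧸ Ideal.span {τ}) := by
    refine isNoetherianRing_of_surjective A _
      ((Ideal.Quotient.mk (Ideal.span {τ})).comp (algebraMap A B')) fun y => ?_
    obtain ⟨b, rfl⟩ := Ideal.Quotient.mk_surjective y
    obtain ⟨a, ha⟩ := exists_sub_algebraMap_mem_map_pow I k b
    refine ⟨a, ?_⟩
    rw [RingHom.comp_apply, eq_comm, Ideal.Quotient.mk_eq_mk_iff_sub_mem]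
    have := Ideal.map_mono (f := algebraMap A B') hk ha
    rwa [Ideal.map_span, Set.image_singleton] at this
  have hBt' : IsNoetherian B' (B' ⧸ Ideal.span {τ}) :=
    (LinearMap.isNoetherian_iff_of_bijective
      (⟨⟨id, fun _ _ => rfl⟩, fun _ _ => rfl⟩ :
        (B' ⧸ Ideal.span {τ}) →ₛₗ[Ideal.Quotient.mk (Ideal.span {τ})] (B' ⧸ Ideal.span {τ}))
      Function.bijective_id).2 hBt
  refine IsNoetherianRing.of_prime fun Q hQ => ?_
  by_cases hτ : τ ∈ Q
  · exact fg_of_isNoetherian_quotient_span hτ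
  let J := I.map (algebraMap A B')
  have hτJ : τ ∈ J := Ideal.mem_map_of_mem _ htI
  have hH : IsHausdorff J Q := by
    refine ⟨fun x hx => ?_⟩
    refine Subtype.ext (IsHausdorff.haus (inferInstance : IsHausdorff J B') (x : B') fun n => ?_)
    have h1 := hx n
    rw [SModEq.zero] at h1 ⊢
    have h2 := Submodule.mem_map_of_mem (f := Q.subtype) h1
    rw [Submodule.map_smul''] at h2
    exact Submodule.smul_mono le_rfl le_top h2
  let f : Q →ₗ[B'] (B' ⧸ Ideal.span {τ}) := (Submodule.mkQ (Ideal.span {τ})) ∘ₗ Q.subtype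
  have hfin : IsNoetherian B' (Q ⧸ (J • ⊤ : Submodule B' Q)) := by
    refine isNoetherian_of_ker_le f (Submodule.mkQ _) (Submodule.mkQ_surjective _) ?_
    rintro ⟨x, hx⟩ hker
    have h1 : Submodule.mkQ (Ideal.span {τ}) x = 0 := hker
    rw [Submodule.mkQ_apply, Submodule.Quotient.mk_eq_zero] at h1
    obtain ⟨c, rfl⟩ := Ideal.mem_span_singleton'.1 h1
    rw [LinearMap.mem_ker, Submodule.mkQ_apply, Submodule.Quotient.mk_eq_zero]
    have hc : c ∈ Q := (hQ.mem_or_mem hx).resolve_right hτ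
    have : (⟨c * τ, hx⟩ : Q) = τ • ⟨c, hc⟩ := Subtype.ext (mul_comm _ _)
    rw [this]
    exact Submodule.smul_mem_smul hτJ Submodule.mem_top
  have := finite_of_finite_quotient_smul_top J Q
  exact Module.Finite.iff_fg.1 this

/-- By flatness a nonzero element of `A` is regular in the completion, while minimal primes consist
of zero divisors. -/
theorem notMem_minimalPrimes_of_comap_ne_bot [IsDomain A] (Q : Ideal (AdicCompletion I A))
    (hQ : Q.comap (algebraMap A (AdicCompletion I A)) ≠ ⊥) :
    Q ∉ minimalPrimes (AdicCompletion I A) := by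
  intro hmin
  obtain ⟨a, haQ, ha0⟩ := Submodule.exists_mem_ne_zero_of_ne_bot hQ
  have h1 := (Ideal.disjoint_nonZeroDivisors_of_mem_minimalPrimes hmin)
  refine Set.disjoint_left.1 h1 haQ ?_
  have hreg : IsSMulRegular (AdicCompletion I A) (algebraMap A (AdicCompletion I A) a) :=
    IsSMulRegular.of_flat fun x y h => mul_left_cancel₀ ha0 h
  exact mem_nonZeroDivisors_iff_left.2 fun x hx => hreg (by simpa using hx)

theorem eq_map_comap_of_map_le {P : Ideal (AdicCompletion I A)}
    (hP : I.map (algebraMap A (AdicCompletion I A)) ≤ P) :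
    P = (P.comap (algebraMap A (AdicCompletion I A))).map (algebraMap A (AdicCompletion I A)) := by
  refine le_antisymm (fun b hb => ?_) Ideal.map_comap_le
  obtain ⟨a, ha⟩ := exists_sub_algebraMap_mem_map_pow I 1 b
  rw [pow_one] at ha
  have haP : algebraMap A _ a ∈ P := by
    have := P.sub_mem hb (hP ha)
    rwa [sub_sub_cancel] at this
  have hI : I ≤ P.comap (algebraMap A (AdicCompletion I A)) := Ideal.map_le_iff_le_comap.1 hP
  rw [← sub_add_cancel b (algebraMap A _ a)]
  exact Ideal.add_mem _ (Ideal.map_mono hI ha) (Ideal.mem_map_of_mem _ haP)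

theorem comap_lt_comap_of_map_le {P P' : Ideal (AdicCompletion I A)}
    (hP : I.map (algebraMap A (AdicCompletion I A)) ≤ P) (h : P < P') :
    P.comap (algebraMap A (AdicCompletion I A)) < P'.comap (algebraMap A (AdicCompletion I A)) := by
  refine lt_of_le_of_ne (Ideal.comap_mono h.le) fun heq => h.ne ?_
  rw [eq_map_comap_of_map_le I hP, eq_map_comap_of_map_le I (hP.trans h.le), heq]

end Completion

/-! ### Finiteness tested on prime quotients -/

section FiniteLengthAlgebras

variable {R N : Type*} [CommRing R] [CommRing N] [Algebra R N]

/-- `J/IJ` is a quotient of a finite power of `N/I`. -/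
theorem finite_quotient_mul (I J : Ideal N) (hJ : J.FG) [Module.Finite R (N ⧸ I)]
    [Module.Finite R (N ⧸ J)] : Module.Finite R (N ⧸ I * J) := by
  obtain ⟨n, g, hg⟩ := Submodule.fg_iff_exists_fin_generating_family.1 hJ
  let f : (N ⧸ I * J) →ₗ[R] (N ⧸ J) := (Ideal.Quotient.factorₐ R Ideal.mul_le_right).toLinearMap
  have hgJ : ∀ i, g i ∈ J := fun i => hg ▸ Submodule.subset_span ⟨i, rfl⟩
  let μ : Fin n → (N ⧸ I) →ₗ[R] (N ⧸ I * J) := fun i =>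
    (I.restrictScalars R).liftQ
      ((Ideal.Quotient.mkₐ R (I * J)).toLinearMap ∘ₗ (LinearMap.mulRight R (g i))) (by
        intro x hx
        exact Ideal.Quotient.eq_zero_iff_mem.2 (Ideal.mul_mem_mul hx (hgJ i)))
  have hμ : ∀ i x, μ i (Ideal.Quotient.mk I x) = Ideal.Quotient.mk (I * J) (x * g i) :=
    fun i x => rfl
  refine ⟨Submodule.fg_of_fg_map_of_fg_inf_ker f ?_ ?_⟩
  · rw [Submodule.map_top]
    have : Function.Surjective f := Ideal.Quotient.factor_surjective Ideal.mul_le_right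
    rw [LinearMap.range_eq_top.2 this]
    exact Module.Finite.fg_top
  · have hle : ⊤ ⊓ LinearMap.ker f = LinearMap.range (LinearMap.lsum R (fun _ => N ⧸ I) R μ) := by
      rw [top_inf_eq]
      apply le_antisymm
      · intro x hx
        obtain ⟨x, rfl⟩ := Ideal.Quotient.mk_surjective x
        have hxJ : x ∈ J := Ideal.Quotient.eq_zero_iff_mem.1 hx
        rw [← hg, Submodule.mem_span_range_iff_exists_fun] at hxJ
        obtain ⟨c, rfl⟩ := hxJ
        refine ⟨fun i => Ideal.Quotient.mk I (c i), ?_⟩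
        rw [LinearMap.lsum_apply, LinearMap.sum_apply, map_sum]
        exact Finset.sum_congr rfl fun i _ => hμ i (c i)
      · rintro _ ⟨c, rfl⟩
        rw [LinearMap.lsum_apply, LinearMap.sum_apply]
        refine Submodule.sum_mem _ fun i _ => ?_
        obtain ⟨y, hy⟩ := Ideal.Quotient.mk_surjective (c i)
        rw [LinearMap.comp_apply, LinearMap.proj_apply, ← hy, hμ]
        exact Ideal.Quotient.eq_zero_iff_mem.2 (Ideal.mul_mem_left _ _ (hgJ i))
    rw [hle, LinearMap.range_eq_map]
    exact Module.Finite.fg_top.map _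

/-- In a noetherian ring some finite product of primes vanishes, so multiplying in one prime at a
time reaches `N`. -/
theorem finite_of_finite_quotient_isPrime [IsNoetherianRing N]
    (h : ∀ P : Ideal N, P.IsPrime → Module.Finite R (N ⧸ P)) : Module.Finite R N := by
  obtain ⟨Z, hZ⟩ := PrimeSpectrum.exists_primeSpectrum_prod_le N ⊥
  have key : ∀ Z : Multiset (PrimeSpectrum N),
      Module.Finite R (N ⧸ (Z.map PrimeSpectrum.asIdeal).prod) := by
    intro Z
    induction Z using Multiset.induction_on with
    | empty =>
      have : Subsingleton
          (N ⧸ (Multiset.map PrimeSpectrum.asIdeal (0 : Multiset (PrimeSpectrum N))).prod) := by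
        rw [Multiset.map_zero, Multiset.prod_zero, Ideal.one_eq_top]
        exact Ideal.Quotient.subsingleton_iff.2 rfl
      infer_instance
    | cons P Z ih =>
      rw [Multiset.map_cons, Multiset.prod_cons]
      have := h P.asIdeal P.isPrime
      exact finite_quotient_mul _ _ (IsNoetherian.noetherian _)
  have h1 := key Z
  rw [le_bot_iff.1 hZ] at h1
  exact Module.Finite.equiv ((AlgEquiv.quotientBot R N).toLinearEquiv)

end FiniteLengthAlgebras

/-! ### Primes of the completed ring -/

section CompletedRegularRing

open IsLocalRing (maximalIdeal)

variable {R A : Type u} [CommRing R] [IsLocalRing R] [IsNoetherianRing R]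
  [IsAdicComplete (maximalIdeal R) R] [CommRing A] [Algebra R A]

/-- The completion of `A` along the maximal ideal of `R`. -/
abbrev BaseCompletion (R A : Type*) [CommRing R] [IsLocalRing R] [CommRing A] [Algebra R A] :=
  AdicCompletion ((maximalIdeal R).map (algebraMap R A)) A

/-- Either `m` kills `A/p`, whose topology is then discrete, or `A/p` is finite over the complete
ring `R`. -/
theorem IsRegularRing.isAdicComplete_quotient (hA : IsRegularRing R A) (p : Ideal A)
    [hp : p.IsPrime]
    (hp0 : p ≠ ⊥) : IsAdicComplete ((maximalIdeal R).map (algebraMap R A)) (A ⧸ p) := by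
  by_cases h : maximalIdeal R ≤ p.comap (algebraMap R A)
  · rw [← IsAdicComplete.map_algebraMap_iff (S := A ⧸ p)]
    have : ((maximalIdeal R).map (algebraMap R A)).map (algebraMap A (A ⧸ p)) = ⊥ := by
      rw [eq_bot_iff, Ideal.map_le_iff_le_comap, ← RingHom.ker_eq_comap_bot,
        Ideal.Quotient.algebraMap_eq, Ideal.mk_ker]
      exact Ideal.map_le_iff_le_comap.2 h
    rw [this]
    infer_instance
  · have := hA.finite p hp hp0 h
    rw [IsAdicComplete.map_algebraMap_iff]
    have := isPrecomplete_of_finite (maximalIdeal R) (A ⧸ p)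
    exact { }

theorem IsRegularRing.bijective_quotientMap (hA : IsRegularRing R A) (p : Ideal A) [hp : p.IsPrime]
    (hp0 : p ≠ ⊥) :
    Function.Bijective (Ideal.quotientMap (p.map (algebraMap A (BaseCompletion R A)))
      (algebraMap A (BaseCompletion R A)) Ideal.le_comap_map) := by
  have := hA.isNoetherianRing
  have := hA.isAdicComplete_quotient p hp0
  exact bijective_quotientMap_adicCompletion _ p

theorem IsRegularRing.isPrime_map (hA : IsRegularRing R A) (p : Ideal A) [hp : p.IsPrime]
    (hp0 : p ≠ ⊥) : (p.map (algebraMap A (BaseCompletion R A))).IsPrime := by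
  let e := RingEquiv.ofBijective _ (hA.bijective_quotientMap p hp0)
  have : IsDomain (BaseCompletion R A ⧸ p.map (algebraMap A (BaseCompletion R A))) :=
    e.symm.toMulEquiv.isDomain _
  exact (Ideal.Quotient.isDomain_iff_prime _).1 this

theorem IsRegularRing.comap_map (hA : IsRegularRing R A) (p : Ideal A) [hp : p.IsPrime]
    (hp0 : p ≠ ⊥) :
    (p.map (algebraMap A (BaseCompletion R A))).comap (algebraMap A (BaseCompletion R A)) = p := by
  refine le_antisymm (fun a ha => ?_) Ideal.le_comap_map
  have h := (hA.bijective_quotientMap p hp0).1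
  rw [injective_iff_map_eq_zero] at h
  refine Ideal.Quotient.eq_zero_iff_mem.1 (h (Ideal.Quotient.mk p a) ?_)
  rw [Ideal.quotientMap_mk]
  exact Ideal.Quotient.eq_zero_iff_mem.2 ha

omit [IsAdicComplete (maximalIdeal R) R] in
theorem exists_pow_le_span (hR : ∀ p : Ideal R, p.IsPrime → p ≠ ⊥ → p = maximalIdeal R)
    {t : R} (ht0 : t ≠ 0) : ∃ k, maximalIdeal R ^ k ≤ Ideal.span {t} := by
  obtain ⟨k, hk⟩ := (Ideal.span {t}).exists_radical_pow_le_of_fg (IsNoetherian.noetherian _)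
  refine ⟨k, le_trans (Ideal.pow_right_mono ?_ k) hk⟩
  rw [Ideal.radical_eq_sInf]
  refine le_sInf fun p ⟨hp, hpp⟩ => (hR p hpp fun h => ht0 ?_).ge
  simpa [h] using hp (Ideal.mem_span_singleton_self t)

omit [IsAdicComplete (maximalIdeal R) R] in
theorem IsRegularRing.isNoetherianRing_baseCompletion (hA : IsRegularRing R A)
    (hR0 : maximalIdeal R ≠ ⊥)
    (hR : ∀ p : Ideal R, p.IsPrime → p ≠ ⊥ → p = maximalIdeal R) :
    ∃ t ∈ maximalIdeal R, t ≠ 0 ∧ ∃ k, ((maximalIdeal R).map (algebraMap R A)) ^ k ≤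
      Ideal.span {algebraMap R A t} ∧ IsNoetherianRing (BaseCompletion R A) := by
  have := hA.isNoetherianRing
  obtain ⟨t, ht, ht0⟩ := Submodule.exists_mem_ne_zero_of_ne_bot hR0
  obtain ⟨k, hk⟩ := exists_pow_le_span hR ht0
  have h1 : ((maximalIdeal R).map (algebraMap R A)) ^ k ≤ Ideal.span {algebraMap R A t} := by
    rw [← Ideal.map_pow, ← Set.image_singleton, ← Ideal.map_span]
    exact Ideal.map_mono hk
  exact ⟨t, ht, ht0, k, h1, isNoetherianRing_adicCompletion _ (Ideal.mem_map_of_mem _ ht) h1⟩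

/-- Non-minimal primes of the completion do not contract to zero. -/
theorem IsRegularRing.comap_ne_bot (hA : IsRegularRing R A) (hR0 : maximalIdeal R ≠ ⊥)
    (hR : ∀ p : Ideal R, p.IsPrime → p ≠ ⊥ → p = maximalIdeal R)
    (Q : Ideal (BaseCompletion R A)) [hQ : Q.IsPrime]
    (hmin : Q ∉ minimalPrimes (BaseCompletion R A)) :
    Q.comap (algebraMap A (BaseCompletion R A)) ≠ ⊥ := by
  intro hbot
  have := hA.isNoetherianRing
  obtain ⟨t, htm, ht0, k, hk, hnoeth⟩ := hA.isNoetherianRing_baseCompletion hR0 hR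
  let B := BaseCompletion R A
  let I := (maximalIdeal R).map (algebraMap R A)
  let J : Ideal B := I.map (algebraMap A B)
  let τ : B := algebraMap A B (algebraMap R A t)
  have htA : algebraMap R A t ≠ 0 := fun h => ht0 (hA.injective (h.trans (map_zero _).symm))
  have hτJ : τ ∈ J := Ideal.mem_map_of_mem _ (Ideal.mem_map_of_mem _ htm)
  have hτQ : τ ∉ Q := fun h => htA (by
    have : algebraMap R A t ∈ Q.comap (algebraMap A B) := h
    rwa [hbot, Ideal.mem_bot] at this)
  have hJP : ∀ P : Ideal B, P.IsPrime → τ ∈ P → J ≤ P := by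
    intro P hP hτ
    have h1 : J ^ k ≤ P := by
      rw [← Ideal.map_pow]
      refine (Ideal.map_mono hk).trans ?_
      rw [Ideal.map_span, Set.image_singleton, Ideal.span_singleton_le_iff_mem]
      exact hτ
    exact hP.le_of_pow_le h1
  obtain ⟨Q₀, hQ₀, hQ₀Q⟩ : ∃ Q₀ : Ideal B, Q₀.IsPrime ∧ Q₀ < Q := by
    by_contra! hcon
    exact hmin ⟨⟨hQ, bot_le⟩, fun q hq hqQ => by
      by_contra h
      exact hcon q hq.1 (lt_of_le_not_ge hqQ h)⟩
  have hcne : ∀ P : Ideal B, τ ∈ P → P.comap (algebraMap A B) ≠ ⊥ := fun P hP h => htA (by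
    have : algebraMap R A t ∈ P.comap (algebraMap A B) := hP
    rwa [h, Ideal.mem_bot] at this)
  -- primes containing `Q` and `τ` are not minimal over `τ`
  have hbelow : ∀ P : Ideal B, P.IsPrime → Q < P → τ ∈ P →
      ∃ P' : Ideal B, P'.IsPrime ∧ τ ∈ P' ∧ P' < P := by
    intro P hP hQP hτP
    by_contra! hcon
    have h1 : P ∈ (Ideal.span {τ}).minimalPrimes :=
      ⟨⟨hP, by simpa [Ideal.span_le] using hτP⟩, fun q hq hqP => by
        by_contra h
        exact hcon q hq.1 (hq.2 (Ideal.mem_span_singleton_self τ)) (lt_of_le_not_ge hqP h)⟩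
    have h2 := Ideal.height_le_one_of_isPrincipal_of_mem_minimalPrimes (Ideal.span {τ}) P h1
    have e0 := Ideal.height_add_one_le_of_lt_of_isPrime hQ₀Q
    have e1 := Ideal.height_add_one_le_of_lt_of_isPrime hQP
    have e2 : Q₀.height + 1 + 1 ≤ 1 := le_trans (by gcongr) (e1.trans h2)
    have e3 : (2 : ℕ∞) ≤ Q₀.height + 1 + 1 := by
      rw [add_assoc]
      exact le_add_self
    exact absurd (e3.trans e2) (by decide)
  -- Primes containing `J` are determined by their contractions, so the strict inclusion `P' < P`
  -- remains strict in `A`.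
  have hover : ∀ P : Ideal B, P.IsPrime → Q ⊔ J ≤ P →
      ∃ p : Ideal A, p.IsPrime ∧ p ≠ ⊥ ∧ I ≤ p ∧ p < P.comap (algebraMap A B) := by
    intro P hP hle
    have hτP : τ ∈ P := hle (Ideal.mem_sup_right hτJ)
    have hQP : Q < P := lt_of_le_of_ne (le_sup_left.trans hle) fun h => hτQ (h ▸ hτP)
    obtain ⟨P', hP', hτP', hlt⟩ := hbelow P hP hQP hτP
    exact ⟨P'.comap (algebraMap A B), inferInstance, hcne P' hτP',
      Ideal.map_le_iff_le_comap.1 (hJP P' hP' hτP'),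
      comap_lt_comap_of_map_le I (hJP P' hP' hτP') hlt⟩
  let N := B ⧸ (Q ⊔ J)
  have hNfin : Module.Finite R N := by
    refine finite_of_finite_quotient_isPrime fun P hP => ?_
    let P' : Ideal B := P.comap (Ideal.Quotient.mk (Q ⊔ J))
    have hP' : Q ⊔ J ≤ P' := fun x hx => by
      rw [Ideal.mem_comap, Ideal.Quotient.eq_zero_iff_mem.2 hx]
      exact P.zero_mem
    obtain ⟨p, hp, hp0, -, hlt⟩ := hover P' inferInstance hP'
    have hfin := (hA.of_lt p _ hp hp0 inferInstance hlt).2.2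
    let c := P'.comap (algebraMap A B)
    let g : (A ⧸ c) →ₐ[R] (N ⧸ P) := Ideal.Quotient.liftₐ c
      (((Ideal.Quotient.mkₐ R P).comp (Ideal.Quotient.mkₐ R (Q ⊔ J))).comp
        (IsScalarTower.toAlgHom R A B)) fun a ha => Ideal.Quotient.eq_zero_iff_mem.2 ha
    have hg : Function.Surjective g := by
      intro y
      obtain ⟨y, rfl⟩ := Ideal.Quotient.mk_surjective y
      obtain ⟨b, rfl⟩ := Ideal.Quotient.mk_surjective y
      obtain ⟨a, ha⟩ := exists_sub_algebraMap_mem_map_pow I 1 b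
      rw [pow_one] at ha
      refine ⟨Ideal.Quotient.mk c a, ?_⟩
      have : Ideal.Quotient.mk (Q ⊔ J) b = Ideal.Quotient.mk (Q ⊔ J) (algebraMap A B a) :=
        (Ideal.Quotient.mk_eq_mk_iff_sub_mem _ _).2 (Ideal.mem_sup_right ha)
      rw [this]
      rfl
    exact Module.Finite.of_surjective g.toLinearMap hg
  have hJB : J ≠ ⊤ ∧ Q ⊔ J ≠ ⊤ := by
    have := isAdicComplete_map_adicCompletion I
    obtain ⟨M, hM, hQM⟩ := Ideal.exists_le_maximal Q hQ.ne_top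
    have hJM : J ≤ M := (IsAdicComplete.le_jacobson_bot J).trans
      (sInf_le ⟨bot_le, hM⟩)
    exact ⟨ne_top_of_le_ne_top hM.ne_top hJM, ne_top_of_le_ne_top hM.ne_top (sup_le hQM hJM)⟩
  let C := B ⧸ Q
  have hmB : (maximalIdeal R).map (algebraMap R B) = J := by
    rw [IsScalarTower.algebraMap_eq R A B, ← Ideal.map_map]
  have hmC : (maximalIdeal R).map (algebraMap R C) = (Q ⊔ J).map (Ideal.Quotient.mk Q) := by
    rw [Ideal.map_sup, Ideal.map_quotient_self, bot_sup_eq, ← hmB, Ideal.map_map]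
    rfl
  have hmCt : (maximalIdeal R).map (algebraMap R C) ≠ ⊤ := by
    rw [hmC]
    intro ht
    apply hJB.2
    have h2 := congrArg (Ideal.comap (Ideal.Quotient.mk Q)) ht
    rwa [Ideal.comap_map_of_surjective' _ Ideal.Quotient.mk_surjective, Ideal.mk_ker,
      sup_eq_left.2 le_sup_left, Ideal.comap_top] at h2
  have hH : IsHausdorff (maximalIdeal R) C :=
    IsHausdorff.map_algebraMap_iff.1 (IsHausdorff.of_isDomain _ hmCt)
  have hfin2 : Module.Finite R (C ⧸ (maximalIdeal R • ⊤ : Submodule R C)) := by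
    let g : N →ₗ[R] (C ⧸ (maximalIdeal R • ⊤ : Submodule R C)) :=
      ((Q ⊔ J).restrictScalars R).liftQ
        ((Submodule.mkQ (maximalIdeal R • ⊤ : Submodule R C)) ∘ₗ
          (Ideal.Quotient.mkₐ R Q).toLinearMap) (by
        intro x hx
        rw [LinearMap.mem_ker, LinearMap.comp_apply, Submodule.mkQ_apply,
          Submodule.Quotient.mk_eq_zero, Ideal.smul_top_eq_map, hmC]
        exact Ideal.mem_map_of_mem _ hx)
    refine Module.Finite.of_surjective g ?_
    intro c
    obtain ⟨c, rfl⟩ := Submodule.mkQ_surjective _ c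
    obtain ⟨a, rfl⟩ := Ideal.Quotient.mk_surjective c
    exact ⟨Ideal.Quotient.mk (Q ⊔ J) a, rfl⟩
  have hCfin := finite_of_finite_quotient_smul_top (maximalIdeal R) C
  -- Since `Q ∩ A = 0`, the ring `A` embeds in the finite `R`-module `B/Q`.
  have hAfin : Module.Finite R A := by
    refine Module.Finite.of_injective
      ((Ideal.Quotient.mkₐ R Q).comp (IsScalarTower.toAlgHom R A B)).toLinearMap ?_
    rw [← LinearMap.ker_eq_bot, eq_bot_iff]
    intro a ha
    have : a ∈ Q.comap (algebraMap A B) :=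
      (Ideal.Quotient.eq_zero_iff_mem (I := Q)).1 (LinearMap.mem_ker.1 ha)
    rw [hbot] at this
    exact this
  -- Now `A` is integral over `R`, so a prime over `m` is maximal; yet `hover` puts such a prime
  -- strictly below another.
  obtain ⟨M, hM, hQM⟩ := Ideal.exists_le_maximal (Q ⊔ J) hJB.2
  obtain ⟨p, hp, -, hIp, hlt⟩ := hover M hM.isPrime hQM
  have hpm : p.comap (algebraMap R A) = maximalIdeal R :=
    ((IsLocalRing.maximalIdeal.isMaximal R).eq_of_le (Ideal.IsPrime.ne_top inferInstance)
      (Ideal.map_le_iff_le_comap.1 hIp)).symm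
  have hpmax : p.IsMaximal := by
    have : Algebra.IsIntegral R A := inferInstance
    refine Ideal.isMaximal_of_isIntegral_of_isMaximal_comap (R := R) p ?_
    rw [hpm]
    infer_instance
  exact (Ideal.IsPrime.ne_top inferInstance) (hpmax.1.2 _ hlt)

/-- With `q = Q ∩ A` nonzero, `B = A + qB` and `qB ⊆ Q`; the `A`-component of an element of `Q` then
lies in `q`. -/
theorem IsRegularRing.eq_map_comap (hA : IsRegularRing R A) (hR0 : maximalIdeal R ≠ ⊥)
    (hR : ∀ p : Ideal R, p.IsPrime → p ≠ ⊥ → p = maximalIdeal R)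
    (Q : Ideal (BaseCompletion R A)) [hQ : Q.IsPrime]
    (hmin : Q ∉ minimalPrimes (BaseCompletion R A)) :
    Q = (Q.comap (algebraMap A (BaseCompletion R A))).map (algebraMap A (BaseCompletion R A)) ∧
    ∀ b, ∃ a, b - algebraMap A (BaseCompletion R A) a ∈ Q := by
  have hq0 := hA.comap_ne_bot hR0 hR Q hmin
  have key : ∀ b, ∃ a, b - algebraMap A (BaseCompletion R A) a ∈
      (Q.comap (algebraMap A (BaseCompletion R A))).map (algebraMap A (BaseCompletion R A)) := by
    intro b
    obtain ⟨a, ha⟩ := (hA.bijective_quotientMap _ hq0).2 (Ideal.Quotient.mk _ b)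
    obtain ⟨a, rfl⟩ := Ideal.Quotient.mk_surjective a
    rw [Ideal.quotientMap_mk, eq_comm, Ideal.Quotient.mk_eq_mk_iff_sub_mem] at ha
    exact ⟨a, ha⟩
  refine ⟨le_antisymm (fun b hb => ?_) Ideal.map_comap_le, fun b => ?_⟩
  · obtain ⟨a, ha⟩ := key b
    have haQ : algebraMap A _ a ∈ Q := by
      have := Q.sub_mem hb (Ideal.map_comap_le ha)
      rwa [sub_sub_cancel] at this
    rw [← sub_add_cancel b (algebraMap A _ a)]
    exact Ideal.add_mem _ ha (Ideal.mem_map_of_mem _ haQ)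
  · obtain ⟨a, ha⟩ := key b
    exact ⟨a, Ideal.map_comap_le ha⟩

theorem bijective_residueFieldMap {A B : Type*} [CommRing A] [CommRing B] (φ : A →+* B)
    (Q : Ideal B)
    [Q.IsPrime] (h : ∀ b, ∃ a, b - φ a ∈ Q) :
    Function.Bijective (Ideal.ResidueField.map (Q.comap φ) Q φ rfl) := by
  refine ⟨RingHom.injective _, fun x => ?_⟩
  have key : ∀ b, ∃ z, Ideal.ResidueField.map (Q.comap φ) Q φ rfl z =
      algebraMap B Q.ResidueField b := by
    intro b
    obtain ⟨a, ha⟩ := h b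
    refine ⟨algebraMap A _ a, ?_⟩
    rw [Ideal.ResidueField.map_algebraMap, eq_comm, ← sub_eq_zero, ← map_sub,
      Ideal.algebraMap_residueField_eq_zero]
    exact ha
  obtain ⟨b, c, -, rfl⟩ := IsFractionRing.div_surjective (A := B ⧸ Q) x
  obtain ⟨b, rfl⟩ := Ideal.Quotient.mk_surjective b
  obtain ⟨c, rfl⟩ := Ideal.Quotient.mk_surjective c
  obtain ⟨z, hz⟩ := key b
  obtain ⟨w, hw⟩ := key c
  refine ⟨z / w, ?_⟩
  rw [map_div₀, hz, hw, Ideal.algebraMap_quotient_residueField_mk,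
    Ideal.algebraMap_quotient_residueField_mk]

theorem IsRegularRing.primes_completion [IsDomain A] (hA : IsRegularRing R A) (hR0 : maximalIdeal R ≠ ⊥)
    (hR : ∀ p : Ideal R, p.IsPrime → p ≠ ⊥ → p = maximalIdeal R) :
    let B := BaseCompletion R A
    (∀ p : Ideal A, p.IsPrime → p ≠ ⊥ →
      Function.Bijective
        (Ideal.quotientMap (p.map (algebraMap A B)) (algebraMap A B) Ideal.le_comap_map) ∧
      (p.map (algebraMap A B)).IsPrime) ∧
    (∀ (Q : Ideal B) [Q.IsPrime], Q ∉ minimalPrimes B →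
      Q = (Q.comap (algebraMap A B)).map (algebraMap A B) ∧
      Function.Bijective
        (Ideal.ResidueField.map (Q.comap (algebraMap A B)) Q (algebraMap A B) rfl)) ∧
    (Set.BijOn (Ideal.map (algebraMap A B))
        {p : Ideal A | p.IsPrime ∧ p ∉ minimalPrimes A}
        {Q : Ideal B | Q.IsPrime ∧ Q ∉ minimalPrimes B} ∧
      Set.InvOn (Ideal.comap (algebraMap A B)) (Ideal.map (algebraMap A B))
        {p : Ideal A | p.IsPrime ∧ p ∉ minimalPrimes A}
        {Q : Ideal B | Q.IsPrime ∧ Q ∉ minimalPrimes B}) := by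
  intro B
  have := hA.isNoetherianRing
  have hmin : ∀ p : Ideal A, p ∉ minimalPrimes A ↔ p ≠ ⊥ := fun p => by
    rw [IsDomain.minimalPrimes_eq_singleton_bot, Set.mem_singleton_iff]
  have hinv : Set.InvOn (Ideal.comap (algebraMap A B)) (Ideal.map (algebraMap A B))
        {p : Ideal A | p.IsPrime ∧ p ∉ minimalPrimes A}
        {Q : Ideal B | Q.IsPrime ∧ Q ∉ minimalPrimes B} := by
    refine ⟨fun p ⟨hp, hp'⟩ => hA.comap_map p ((hmin p).1 hp'), fun Q ⟨hQ, hQ'⟩ => ?_⟩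
    exact (hA.eq_map_comap hR0 hR Q hQ').1.symm
  refine ⟨fun p hp hp0 => ⟨hA.bijective_quotientMap p hp0, hA.isPrime_map p hp0⟩,
    fun Q hQ hQ' => ⟨(hA.eq_map_comap hR0 hR Q hQ').1,
      bijective_residueFieldMap _ Q (hA.eq_map_comap hR0 hR Q hQ').2⟩, hinv.bijOn ?_ ?_, hinv⟩
  · rintro p ⟨hp, hp'⟩
    have hp0 := (hmin p).1 hp'
    refine ⟨hA.isPrime_map p hp0, notMem_minimalPrimes_of_comap_ne_bot _ _ ?_⟩
    rwa [hA.comap_map p hp0]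
  · rintro Q ⟨hQ, hQ'⟩
    exact ⟨inferInstance, (hmin _).2 (hA.comap_ne_bot hR0 hR Q hQ')⟩

end CompletedRegularRing

/-! ### Translation from schemes to rings -/

section AffineOpens

variable {R : Type u} [CommRing R] {X : Scheme.{u}} (f : X ⟶ Spec (CommRingCat.of R))
  {W : X.Opens}

/-- The structure map from the base ring to the sections over an open set of an `R`-scheme. -/
noncomputable def toSections (W : X.Opens) : R →+* Γ(X, W) :=
  ((Scheme.ΓSpecIso (CommRingCat.of R)).inv ≫ f.appLE ⊤ W (by simp)).hom

theorem germToFunctionField_toSections [IsIntegral X] [Nonempty W] (r : R) :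
    algebraMap Γ(X, W) X.functionField (toSections f W r) = toFunctionField f r := by
  change (X.germToFunctionField W).hom
    (((Scheme.ΓSpecIso (CommRingCat.of R)).inv ≫ f.appLE ⊤ W (by simp)).hom r) = _
  rw [toFunctionField, ← CommRingCat.comp_apply]
  congr 2
  simp only [Scheme.germToFunctionField, Scheme.Hom.appLE, Category.assoc,
    TopCat.Presheaf.germ_res]
  rfl

theorem fromSpec_comp (hW : IsAffineOpen W) :
    hW.fromSpec ≫ f = Spec.map (CommRingCat.ofHom (toSections f W)) := by
  rw [← IsAffineOpen.SpecMap_appLE_fromSpec f (isAffineOpen_top _) hW (by simp),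
    IsAffineOpen.fromSpec_top, Scheme.isoSpec_Spec_inv, ← Spec.map_comp]
  rfl

theorem fromSpec_comp_apply (hW : IsAffineOpen W) (p : PrimeSpectrum Γ(X, W)) :
    f (hW.fromSpec p) = PrimeSpectrum.comap (toSections f W) p := by
  exact congrArg (fun g : Spec Γ(X, W) ⟶ Spec (CommRingCat.of R) ↦ g p) (fromSpec_comp f hW)

theorem comap_primeIdealOf (hW : IsAffineOpen W) (x : W) :
    (hW.primeIdealOf x).asIdeal.comap (toSections f W) = (f x.1).asIdeal := by
  conv_rhs => rw [← hW.fromSpec_primeIdealOf x, fromSpec_comp_apply]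
  rfl

theorem finiteType_toSections [LocallyOfFiniteType f] (hW : IsAffineOpen W) :
    (toSections f W).FiniteType := by
  refine RingHom.FiniteType.comp (f := (Scheme.ΓSpecIso (CommRingCat.of R)).inv.hom)
    (f.finiteType_appLE (isAffineOpen_top _) hW (by simp)) ?_
  exact RingHom.FiniteType.of_surjective _
    (Scheme.ΓSpecIso (CommRingCat.of R)).symm.commRingCatIsoToRingEquiv.surjective

/-- A dominant morphism sends the generic point of `X` to that of `Spec R`, so the kernel is
contained in the zero prime. -/
theorem toSections_injective [IsDomain R] [IsIntegral X] [IsDominant f] [Nonempty W]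
    (hW : IsAffineOpen W) : Function.Injective (toSections f W) := by
  have hη : genericPoint X ∈ W :=
    (genericPoint_spec X).mem_open_set_iff W.isOpen |>.mpr
      (by obtain ⟨x⟩ := ‹Nonempty W›; exact ⟨x.1, trivial, x.2⟩)
  rw [injective_iff_map_eq_zero]
  intro r hr
  have hmem : r ∈ (f (genericPoint X)).asIdeal := by
    rw [← comap_primeIdealOf f hW ⟨_, hη⟩, Ideal.mem_comap, hr]
    exact Ideal.zero_mem _
  have hgen : IsGenericPoint (f (genericPoint X)) Set.univ := by
    have := (genericPoint_spec X).image f.continuous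
    rwa [Set.image_univ, f.denseRange.closure_range] at this
  have hspec : f (genericPoint X) ⤳ (⟨⊥, Ideal.isPrime_bot⟩ : PrimeSpectrum R) :=
    hgen.specializes trivial
  have := (PrimeSpectrum.le_iff_specializes _ _).mpr hspec
  exact (this hmem : r ∈ (⊥ : Ideal R))

/-- The degree-zero part of the polynomial ring is a quotient of `R`, and `Proj` is of finite type
over its spectrum. -/
theorem IsProjectiveOver.locallyOfFiniteType {f : X ⟶ Spec (CommRingCat.of R)}
    (hf : IsProjectiveOver R f) : LocallyOfFiniteType f := by
  obtain ⟨n, i, hi, rfl⟩ := hf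
  let 𝒜 := MvPolynomial.homogeneousSubmodule (Fin (n + 1)) R
  have : Algebra.FiniteType (𝒜 0) (MvPolynomial (Fin (n + 1)) R) := by
    rw [← RingHom.finiteType_algebraMap]
    refine RingHom.FiniteType.of_comp_finiteType (f := algebraMap R (𝒜 0)) ?_
    have h : (algebraMap (𝒜 0) (MvPolynomial (Fin (n + 1)) R)).comp (algebraMap R (𝒜 0)) =
      algebraMap R (MvPolynomial (Fin (n + 1)) R) := rfl
    rw [h, RingHom.finiteType_algebraMap]
    infer_instance
  have hsurj : Function.Surjective (algebraMap R (𝒜 0)) := by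
    rintro ⟨x, hx⟩
    have h0 : 𝒜 0 = 1 := MvPolynomial.homogeneousSubmodule_zero _
    obtain ⟨r, hr⟩ := Submodule.mem_one.mp (h0 ▸ hx)
    exact ⟨r, Subtype.ext hr⟩
  have : LocallyOfFiniteType (Spec.map (CommRingCat.ofHom (algebraMap R (𝒜 0)))) := by
    rw [HasRingHomProperty.Spec_iff (P := @LocallyOfFiniteType)]
    exact RingHom.FiniteType.of_surjective _ hsurj
  unfold projectiveSpaceHom
  infer_instance

theorem IsNormalScheme.isIntegrallyClosed [IsIntegral X] (hX : IsNormalScheme X)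
    [Nonempty W] (hW : IsAffineOpen W) : IsIntegrallyClosed Γ(X, W) := by
  refine IsIntegrallyClosed.of_localization_maximal fun p _ _ ↦ ?_
  let y : PrimeSpectrum Γ(X, W) := ⟨p, inferInstance⟩
  have hy : hW.fromSpec y ∈ W := hW.range_fromSpec.le (Set.mem_range_self y)
  let := X.presheaf.algebra_section_stalk ⟨hW.fromSpec y, hy⟩
  have : IsLocalization.AtPrime (X.presheaf.stalk (hW.fromSpec y)) p :=
    hW.isLocalization_stalk' y hy
  have := (hX (hW.fromSpec y)).2
  exact IsIntegrallyClosed.of_equiv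
    (IsLocalization.algEquiv p.primeCompl (X.presheaf.stalk (hW.fromSpec y))
      (Localization.AtPrime p)).toRingEquiv

theorem two_le_topologicalKrullDim {T : Type*} [TopologicalSpace T] {x y z : T}
    (hxy : x ⤳ y) (hyx : ¬ y ⤳ x) (hyz : y ⤳ z) (hzy : ¬ z ⤳ y) : 2 ≤ topologicalKrullDim T := by
  let c (t : T) : TopologicalSpace.IrreducibleCloseds T :=
    ⟨closure {t}, isIrreducible_singleton.closure, isClosed_closure⟩
  have hlt {s t : T} (h : s ⤳ t) (h' : ¬ t ⤳ s) : c t < c s :=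
    lt_of_le_not_ge (specializes_iff_closure_subset.mp h)
      fun h'' ↦ h' (specializes_iff_closure_subset.mpr h'')
  -- Specialisation shrinks closures, so the chain is listed from `z` up to `x`.
  exact Order.le_krullDim_iff.mpr ⟨⟨2, ![c z, c y, c x], by
    intro i
    fin_cases i
    · exact hlt hyz hzy
    · exact hlt hxy hyx⟩, rfl⟩

theorem HasCurveFibers.not_chain {f : X ⟶ Spec (CommRingCat.of R)}
    (hf : HasCurveFibers f) (hW : IsAffineOpen W)
    {p q r : PrimeSpectrum Γ(X, W)} (hpq : p < q) (hqr : q < r)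
    (h : PrimeSpectrum.comap (toSections f W) p = PrimeSpectrum.comap (toSections f W) q)
    (h' : PrimeSpectrum.comap (toSections f W) q = PrimeSpectrum.comap (toSections f W) r) :
    False := by
  let s : ↥(Spec (CommRingCat.of R)) := f (hW.fromSpec q)
  have hp : f (hW.fromSpec p) = s := by rw [fromSpec_comp_apply, h, ← fromSpec_comp_apply]
  have hr : f (hW.fromSpec r) = s := by rw [fromSpec_comp_apply, ← h', ← fromSpec_comp_apply]
  let e := (f.fiberHomeo s).symm
  have key {a b : PrimeSpectrum Γ(X, W)} (ha : f (hW.fromSpec a) = s)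
      (hb : f (hW.fromSpec b) = s) : e ⟨_, ha⟩ ⤳ e ⟨_, hb⟩ ↔ a ≤ b := by
    rw [e.isInducing.specializes_iff, ← Topology.IsInducing.subtypeVal.specializes_iff,
      PrimeSpectrum.le_iff_specializes]
    exact hW.fromSpec.isOpenEmbedding.isInducing.specializes_iff
  have h2 := two_le_topologicalKrullDim ((key hp rfl).mpr hpq.le)
    (fun h ↦ hpq.not_ge ((key rfl hp).mp h)) ((key rfl hr).mpr hqr.le)
    (fun h ↦ hqr.not_ge ((key hr rfl).mp h))
  rw [hf s ⟨e ⟨_, rfl⟩⟩] at h2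
  exact absurd h2 (by decide)

/-- The stalk at `x` is the localisation of `Γ(X, W)` at the prime of `x`; this presents `R_U` as an
intersection of localisations. -/
theorem mem_regularOn_iff [IsIntegral X] {U : Set X} [Nonempty W] (hW : IsAffineOpen W)
    (hU : U ⊆ W) (z : X.functionField) :
    z ∈ regularOn X U ↔ ∀ x, ∀ hx : x ∈ U, ∃ s ∉ (hW.primeIdealOf ⟨x, hU hx⟩).asIdeal,
      ∃ r, algebraMap Γ(X, W) X.functionField s * z = algebraMap Γ(X, W) X.functionField r := by
  simp only [regularOn, Subring.mem_iInf]
  refine forall₂_congr fun x hx ↦ ?_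
  let := X.presheaf.algebra_section_stalk ⟨x, hU hx⟩
  have : IsScalarTower Γ(X, W) (X.presheaf.stalk x) X.functionField :=
    functionField_isScalarTower X W ⟨x, hU hx⟩
  have : IsLocalization.AtPrime (X.presheaf.stalk x) (hW.primeIdealOf ⟨x, hU hx⟩).asIdeal :=
    hW.isLocalization_stalk ⟨x, hU hx⟩
  constructor
  · rintro ⟨t, rfl⟩
    obtain ⟨⟨r, s⟩, hrs⟩ :=
      IsLocalization.surj (hW.primeIdealOf ⟨x, hU hx⟩).asIdeal.primeCompl t
    refine ⟨s, s.2, r, ?_⟩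
    rw [IsScalarTower.algebraMap_apply Γ(X, W) (X.presheaf.stalk x) X.functionField,
      IsScalarTower.algebraMap_apply Γ(X, W) (X.presheaf.stalk x) X.functionField, ← map_mul,
      ← hrs, mul_comm]
  · rintro ⟨s, hs, r, hrs⟩
    have := functionField_isFractionRing_of_isAffineOpen X W hW
    refine ⟨IsLocalization.mk' (X.presheaf.stalk x) r
      (⟨s, hs⟩ : (hW.primeIdealOf ⟨x, hU hx⟩).asIdeal.primeCompl), ?_⟩
    have hs0 : algebraMap Γ(X, W) X.functionField s ≠ 0 := by
      rw [Ne, IsFractionRing.to_map_eq_zero_iff]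
      rintro rfl
      exact hs (Ideal.zero_mem _)
    apply mul_left_cancel₀ hs0
    rw [hrs, IsScalarTower.algebraMap_apply Γ(X, W) (X.presheaf.stalk x) X.functionField s,
      ← map_mul, mul_comm, IsLocalization.mk'_spec, ← IsScalarTower.algebraMap_apply]

end AffineOpens

/-! ### The one-dimensional base and the final assembly -/

section Base

open IsLocalRing (maximalIdeal)

variable {R : Type u} [CommRing R] [IsLocalRing R]

theorem maximalIdeal_ne_bot_of_ringKrullDim_eq_one (hR : ringKrullDim R = 1) :
    maximalIdeal R ≠ ⊥ := by
  intro h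
  have := ringKrullDim_eq_zero_of_isField (IsLocalRing.isField_iff_maximalIdeal_eq.mpr h)
  exact absurd (hR.symm.trans this) (by decide)

theorem eq_maximalIdeal_of_ringKrullDim_eq_one [IsDomain R] (hR : ringKrullDim R = 1) {p : Ideal R}
    (hp : p.IsPrime) (hp0 : p ≠ ⊥) : p = maximalIdeal R := by
  have : Ring.KrullDimLE 1 R := Ring.krullDimLE_iff.mpr hR.le
  exact IsLocalRing.eq_maximalIdeal (hp.isMaximal_of_ne_bot hp0)

end Base

/-- For empty `U` the given open may be empty, whereas `Γ(X, W)` must have the function field as its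
fraction field. -/
theorem exists_nonempty_affineOpen {X : Scheme.{u}} [Nonempty X] {U : Set X}
    (hU : ∃ W : X.Opens, IsAffineOpen W ∧ U ⊆ (W : Set X)) :
    ∃ W : X.Opens, Nonempty W ∧ IsAffineOpen W ∧ U ⊆ (W : Set X) := by
  obtain rfl | ⟨x, hx⟩ := U.eq_empty_or_nonempty
  · obtain ⟨x⟩ := ‹Nonempty X›
    obtain ⟨W, hW, hxW, -⟩ := exists_isAffineOpen_mem_and_subset (U := ⊤) (x := x) trivial
    exact ⟨W, ⟨x, hxW⟩, hW, Set.empty_subset _⟩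
  · obtain ⟨W, hW, hUW⟩ := hU
    exact ⟨W, ⟨x, hUW hx⟩, hW, hUW⟩

theorem isRegularRing_regularOn {R : Type u} [CommRing R] [IsDomain R] [IsNoetherianRing R]
    [IsLocalRing R] [IsAdicComplete (IsLocalRing.maximalIdeal R) R] (hR : ringKrullDim R = 1)
    {X : Scheme.{u}} [IsIntegral X] (f : X ⟶ Spec (CommRingCat.of R)) [IsDominant f]
    (hnormal : IsNormalScheme X) (hproj : IsProjectiveOver R f) (hcurve : HasCurveFibers f)
    (U : Set X) (hU : ∀ x ∈ U, f x = IsLocalRing.closedPoint R)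
    (hUaff : ∃ W : X.Opens, IsAffineOpen W ∧ U ⊆ (W : Set X)) :
    letI := (toRegularOn f U).toAlgebra
    IsRegularRing R (regularOn X U) := by
  obtain ⟨W, _, hW, hUW⟩ := exists_nonempty_affineOpen hUaff
  have := hproj.locallyOfFiniteType
  let _ : Algebra R (regularOn X U) := (toRegularOn f U).toAlgebra
  let _ : Algebra R Γ(X, W) := (toSections f W).toAlgebra
  have : Algebra.FiniteType R Γ(X, W) := finiteType_toSections f hW
  have : IsNoetherianRing Γ(X, W) := Algebra.FiniteType.isNoetherianRing R _
  have := hnormal.isIntegrallyClosed hW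
  have := functionField_isFractionRing_of_isAffineOpen X W hW
  have hmem (s : Γ(X, W)) : algebraMap Γ(X, W) X.functionField s ∈ regularOn X U := by
    rw [mem_regularOn_iff hW hUW]
    exact fun x hx ↦ ⟨1, (Ideal.ne_top_iff_one _).mp Ideal.IsPrime.ne_top', s, by simp⟩
  let _ : Algebra Γ(X, W) (regularOn X U) :=
    ((algebraMap Γ(X, W) X.functionField).codRestrict (regularOn X U) hmem).toAlgebra
  have : IsScalarTower Γ(X, W) (regularOn X U) X.functionField :=
    IsScalarTower.of_algebraMap_eq fun _ ↦ rfl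
  have : IsScalarTower R Γ(X, W) (regularOn X U) := IsScalarTower.of_algebraMap_eq fun r ↦
    Subtype.ext (germToFunctionField_toSections f r).symm
  let 𝒰 : Set (Ideal Γ(X, W)) :=
    {y | ∃ x, ∃ hx : x ∈ U, (hW.primeIdealOf ⟨x, hUW hx⟩).asIdeal = y}
  have hA : IsIntersectionOfLocalizations Γ(X, W) (regularOn X U) X.functionField 𝒰 := by
    refine ⟨?_, fun z ↦ ?_⟩
    · rintro _ ⟨x, hx, rfl⟩
      infer_instance
    · trans z ∈ regularOn X U
      · exact ⟨by rintro ⟨a, rfl⟩; exact a.2, fun hz ↦ ⟨⟨z, hz⟩, rfl⟩⟩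
      · rw [mem_regularOn_iff hW hUW]
        exact ⟨by rintro h _ ⟨x, hx, rfl⟩; exact h x hx, fun h x hx ↦ h _ ⟨x, hx, rfl⟩⟩
  refine hA.isRegularRing ⟨toSections_injective f hW, ?_⟩
    (maximalIdeal_ne_bot_of_ringKrullDim_eq_one hR)
    (fun p ↦ eq_maximalIdeal_of_ringKrullDim_eq_one hR) ?_
  · intro 𝔯 P₀ P₁ P₂ _ _ _ h₀ h₁ h₂ h₀₁ h₁₂
    exact hcurve.not_chain hW (p := ⟨P₀, ‹_›⟩) (q := ⟨P₁, ‹_›⟩) (r := ⟨P₂, ‹_›⟩) h₀₁ h₁₂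
      (PrimeSpectrum.ext (h₀.trans h₁.symm)) (PrimeSpectrum.ext (h₁.trans h₂.symm))
  · rintro _ ⟨x, hx, rfl⟩
    refine le_of_eq (Eq.symm ((comap_primeIdealOf f hW ⟨x, hUW hx⟩).trans ?_))
    rw [hU x hx]
    rfl

end WeierstrassCurve32

theorem proposition3p2 {R : Type u} [CommRing R] [IsDomain R] [IsNoetherianRing R] [IsLocalRing R]
    [IsAdicComplete (IsLocalRing.maximalIdeal R) R] (hR : ringKrullDim R = 1)
    {X : Scheme.{u}} [IsIntegral X] (f : X ⟶ Spec (CommRingCat.of R)) [IsDominant f]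
    (hnormal : WeierstrassCurve32.IsNormalScheme X)
    (hproj : WeierstrassCurve32.IsProjectiveOver R f)
    (hcurve : WeierstrassCurve32.HasCurveFibers f)
    (U : Set X) (hU : ∀ x ∈ U, f x = IsLocalRing.closedPoint R)
    (hUaff : ∃ W : X.Opens, IsAffineOpen W ∧ U ⊆ (W : Set X)) :
    let A := WeierstrassCurve32.regularOn X U
    let B := WeierstrassCurve32.completedRegularOn f U
    (∀ p : Ideal A, p.IsPrime → p ≠ ⊥ →
      Function.Bijective
        (Ideal.quotientMap (p.map (algebraMap A B)) (algebraMap A B) Ideal.le_comap_map) ∧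
      (p.map (algebraMap A B)).IsPrime) ∧
    (∀ (Q : Ideal B) [Q.IsPrime], Q ∉ minimalPrimes B →
      Q = (Q.comap (algebraMap A B)).map (algebraMap A B) ∧
      Function.Bijective
        (Ideal.ResidueField.map (Q.comap (algebraMap A B)) Q (algebraMap A B) rfl)) ∧
    (Set.BijOn (Ideal.map (algebraMap A B))
        {p : Ideal A | p.IsPrime ∧ p ∉ minimalPrimes A}
        {Q : Ideal B | Q.IsPrime ∧ Q ∉ minimalPrimes B} ∧
      Set.InvOn (Ideal.comap (algebraMap A B)) (Ideal.map (algebraMap A B))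
        {p : Ideal A | p.IsPrime ∧ p ∉ minimalPrimes A}
        {Q : Ideal B | Q.IsPrime ∧ Q ∉ minimalPrimes B}) := by
  -- With this algebra structure `BaseCompletion` unfolds to `completedRegularOn`, so the algebraic
  -- statement applies definitionally.
  let _ := (WeierstrassCurve32.toRegularOn f U).toAlgebra
  exact (WeierstrassCurve32.isRegularRing_regularOn hR f hnormal hproj hcurve U hU
    hUaff).primes_completion
    (WeierstrassCurve32.maximalIdeal_ne_bot_of_ringKrullDim_eq_one hR)
    fun _ ↦ WeierstrassCurve32.eq_maximalIdeal_of_ringKrullDim_eq_one hR
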